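/- Let $\mathcal O_2$ be the Cuntz algebra, i.e. a nonzero unital $C^*$-algebra generated by two isometries $S_1,S_2$ with $S_1S_1^*+S_2S_2^*=1$. For a word $\mu=(\mu_1,\dots,\mu_k)$ in the letters $1,2$ put $S_\mu=S_{\mu_1}\cdots S_{\mu_k}$ (and $S_\emptyset=1$). Let $\mathcal S_2$ (the Higman–Thompson group) be the group of all unitaries of $\mathcal O_2$ that are finite sums of elements of the form $S_\alpha S_\beta^*$. For a unitary $w\in\mathcal O_2$ let $\lambda_w$ be the unital $*$-endomorphism of $\mathcal O_2$ with $\lambda_w(S_i)=wS_i$ for $i=1,2$, and let $\lambda(\mathcal S_2)^{-1}$ be the set of those $\lambda_w$, $w\in\mathcal S_2$, that are automorphisms of $\mathcal O_2$. Then every element of $\lambda(\mathcal S_2)^{-1}$ restricts to an automorphism of the group $\mathcal S_2$. The set $\lambda(\mathcal S_2)^{-1}|_{\mathcal S_2}$ of these restrictions is a subgroup of $\operatorname{Aut}(\mathcal S_2)$, the group $\mathcal S_2$ is simple and non-abelian, and $$\operatorname{Inn}(\mathcal S_2)\subseteq \lambda(\mathcal S_2)^{-1}|_{\mathcal S_2}\subseteq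 \operatorname{Aut}(\mathcal S_2).$$ In particular the group $\lambda(\mathcal S_2)^{-1}|_{\mathcal S_2}$ is almost simple, i.e. up to isomorphism $H\subseteq \lambda(\mathcal S_2)^{-1}|_{\mathcal S_2}\subseteq\operatorname{Aut}(H)$ for some non-abelian simple group $H$, identified with $\operatorname{Inn}(H)$. -/

import Mathlib

universe u

namespace Cuntz

/-- `S 0, S 1` exhibit the unital C*-algebra `A` as the Cuntz algebra `𝒪₂`: they are isometries,
`S₀ S₀* + S₁ S₁* = 1`, and they generate `A` as a C*-algebra. (For `A ≠ 0` this determines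
`(A, S)` up to a unique isomorphism.) -/
structure IsCuntzPair {A : Type u} [CStarAlgebra A] (S : Fin 2 → A) : Prop where
  isometry : ∀ i, star (S i) * S i = 1
  sum_range : ∑ i, S i * star (S i) = 1
  generates : (StarAlgebra.adjoin ℂ (Set.range S)).topologicalClosure = ⊤

section
variable {A : Type u} [CStarAlgebra A]

/-- `S_μ = S_{μ₁} ⋯ S_{μ_k}` for a word `μ` in the alphabet `{0, 1}`; `S_∅ = 1`. -/
def word (S : Fin 2 → A) (μ : List (Fin 2)) : A := (μ.map S).prod

/-- The finite sums of elements `S_α S_β*`. -/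
def wordSums (S : Fin 2 → A) : AddSubmonoid A :=
  AddSubmonoid.closure
    (Set.range fun p : List (Fin 2) × List (Fin 2) => word S p.1 * star (word S p.2))

lemma word_nil (S : Fin 2 → A) : word S [] = 1 := by simp [word]

lemma word_cons (S : Fin 2 → A) (i : Fin 2) (μ : List (Fin 2)) :
    word S (i :: μ) = S i * word S μ := by simp [word]

lemma word_append (S : Fin 2 → A) (μ ν : List (Fin 2)) :
    word S (μ ++ ν) = word S μ * word S ν := by simp [word]

lemma wordPair_mem (S : Fin 2 → A) (α β : List (Fin 2)) :
    word S α * star (word S β) ∈ wordSums S :=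
  AddSubmonoid.subset_closure ⟨(α, β), rfl⟩

lemma one_mem_wordSums (S : Fin 2 → A) : (1 : A) ∈ wordSums S := by
  simpa [word_nil] using wordPair_mem S [] []

lemma star_mem_wordSums (S : Fin 2 → A) {x : A} (hx : x ∈ wordSums S) :
    star x ∈ wordSums S := by
  induction hx using AddSubmonoid.closure_induction with
  | mem x hx =>
    obtain ⟨p, rfl⟩ := hx
    simpa using wordPair_mem S p.2 p.1
  | zero => simp
  | add x y _ _ hx hy => simpa using add_mem hx hy

namespace IsCuntzPair
variable {S : Fin 2 → A}

lemma orthogonal (hS : IsCuntzPair S) {i j : Fin 2} (hij : i ≠ j) : star (S i) * S j = 0 := by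
  rw [← CStarRing.star_mul_self_eq_zero_iff, star_mul, star_star]
  have hsum : S i * star (S i) + S j * star (S j) = 1 := by
    have h := hS.sum_range
    rw [Fin.sum_univ_two] at h
    fin_cases i <;> fin_cases j <;> simp_all [add_comm]
  have h1 : S i * star (S i) = 1 - S j * star (S j) := eq_sub_of_add_eq hsum
  calc star (S j) * S i * (star (S i) * S j)
      = star (S j) * (S i * star (S i)) * S j := by simp only [mul_assoc]
    _ = star (S j) * S j - (star (S j) * S j) * (star (S j) * S j) := by
        rw [h1]; simp only [mul_sub, sub_mul, mul_one, mul_assoc]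
    _ = 0 := by simp [hS.isometry]

lemma star_word_mul_word (hS : IsCuntzPair S) (β γ : List (Fin 2)) :
    star (word S β) * word S γ = 0 ∨ (∃ δ, star (word S β) * word S γ = word S δ) ∨
      ∃ δ, star (word S β) * word S γ = star (word S δ) := by
  induction β generalizing γ with
  | nil => exact Or.inr (Or.inl ⟨γ, by simp [word_nil]⟩)
  | cons i β ih =>
    cases γ with
    | nil => exact Or.inr (Or.inr ⟨i :: β, by simp [word_nil]⟩)
    | cons j γ =>
      have h : star (word S (i :: β)) * word S (j :: γ)
          = star (word S β) * (star (S i) * S j) * word S γ := by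
        simp only [word_cons, star_mul, mul_assoc]
      rw [h]
      by_cases hij : i = j
      · subst hij
        simpa [hS.isometry] using ih γ
      · left
        simp [hS.orthogonal hij]

lemma mul_mem_wordSums (hS : IsCuntzPair S) {x y : A} (hx : x ∈ wordSums S)
    (hy : y ∈ wordSums S) : x * y ∈ wordSums S := by
  induction hx using AddSubmonoid.closure_induction with
  | zero => simp
  | add x x' _ _ hx hx' => simpa [add_mul] using add_mem hx hx'
  | mem x hx =>
    obtain ⟨⟨α, β⟩, rfl⟩ := hx
    induction hy using AddSubmonoid.closure_induction with
    | zero => simp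
    | add y y' _ _ hy hy' => simpa [mul_add] using add_mem hy hy'
    | mem y hy =>
      obtain ⟨⟨γ, ε⟩, rfl⟩ := hy
      have h : word S α * star (word S β) * (word S γ * star (word S ε))
          = word S α * (star (word S β) * word S γ) * star (word S ε) := by
        simp only [mul_assoc]
      change word S α * star (word S β) * (word S γ * star (word S ε)) ∈ wordSums S
      rw [h]
      rcases hS.star_word_mul_word β γ with h0 | ⟨δ, hδ⟩ | ⟨δ, hδ⟩
      · simp [h0]
      · rw [hδ, ← word_append]
        exact wordPair_mem S _ _
      · rw [hδ, mul_assoc, ← star_mul, ← word_append]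
        exact wordPair_mem S _ _

end IsCuntzPair

/-- The Higman–Thompson group `𝒮₂`: the unitaries of `𝒪₂` that are finite sums of
elements `S_α S_β*`. -/
def thompson (S : Fin 2 → A) (hS : IsCuntzPair S) : Subgroup (unitary A) where
  carrier := {w | (w : A) ∈ wordSums S}
  one_mem' := one_mem_wordSums S
  mul_mem' := fun ha hb => hS.mul_mem_wordSums ha hb
  inv_mem' := fun ha => star_mem_wordSums S ha

/-- `λ(𝒮₂)⁻¹`: the automorphisms of `𝒪₂` of the form `λ_w` with `w ∈ 𝒮₂`. Here `λ_w` is the unital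
*-endomorphism determined by `λ_w(S_i) = w S_i`. -/
def lambdaInv (S : Fin 2 → A) (hS : IsCuntzPair S) : Set (A ≃⋆ₐ[ℂ] A) :=
  {a | ∃ w ∈ thompson S hS, ∀ i, a (S i) = (w : A) * S i}

/-- `λ(𝒮₂)⁻¹|_{𝒮₂}`: the group, under composition, of the automorphisms of `𝒮₂` that are
restrictions to `𝒮₂` of elements of `λ(𝒮₂)⁻¹`. -/
def lambdaRestrict (S : Fin 2 → A) (hS : IsCuntzPair S) :
    Subgroup (MulAut (thompson S hS)) where
  carrier := {t | ∃ a ∈ lambdaInv S hS, ∀ v : thompson S hS,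
    ((t v : unitary A) : A) = a ((v : unitary A) : A)}
  one_mem' := ⟨StarAlgEquiv.refl ℂ A, ⟨1, one_mem _, fun i => by simp⟩, fun v => by simp⟩
  mul_mem' := by
    rintro s t ⟨a, ⟨w, hw, ha⟩, hs⟩ ⟨b, ⟨z, hz, hb⟩, ht⟩
    refine ⟨b.trans a, ⟨(s ⟨z, hz⟩ : thompson S hS) * w, mul_mem (s ⟨z, hz⟩).2 hw, fun i => ?_⟩,
      fun v => ?_⟩
    · have := hs ⟨z, hz⟩
      simp only [StarAlgEquiv.trans_apply, hb, map_mul, ha, Submonoid.coe_mul, this, mul_assoc]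
    · simp [hs, ht]
  inv_mem' := by
    rintro t ⟨a, ⟨w, hw, ha⟩, ht⟩
    have key : ∀ v : thompson S hS,
        (((t⁻¹ : MulAut _) v : unitary A) : A) = a.symm ((v : unitary A) : A) := fun v => by
      have := ht ((t⁻¹ : MulAut _) v)
      rw [MulAut.apply_inv_self] at this
      rw [this, StarAlgEquiv.symm_apply_apply]
    refine ⟨a.symm, ⟨((t⁻¹ : MulAut _) ⟨w, hw⟩⁻¹ : thompson S hS), SetLike.coe_mem _,
      fun i => ?_⟩, key⟩
    rw [key]
    apply EquivLike.injective a
    rw [map_mul, StarAlgEquiv.apply_symm_apply, StarAlgEquiv.apply_symm_apply, ha, ← mul_assoc]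
    have h2 : ((w⁻¹ : unitary A) : A) * (w : A) = 1 := by
      rw [← Submonoid.coe_mul, inv_mul_cancel, Submonoid.coe_one]
    change S i = ((w⁻¹ : unitary A) : A) * (w : A) * S i
    rw [h2, one_mul]
end

/-- `G` is almost simple: up to isomorphism, `H ⊆ G ⊆ Aut(H)` for some non-abelian simple group `H`,
where `H` sits in `Aut(H)` as the group of inner automorphisms. -/
def IsAlmostSimple (G : Type u) [Group G] : Prop :=
  ∃ (H : Type u) (_ : Group H), IsSimpleGroup H ∧ (∃ a b : H, a * b ≠ b * a) ∧
    ∃ f : G →* MulAut H, Function.Injective f ∧ (MulAut.conj : H →* MulAut H).range ≤ f.range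

end Cuntz

/-! ### Prefix order on words -/

namespace Cuntz

/-! Write `P_μ = S_μ S_μ*` and picture `S_μ` as the cylinder of infinite binary words beginning with
`μ`. A finite sum of terms `S_α S_β*` compresses, on a small enough cylinder, to a natural number,
so `-1` is not such a sum. This positivity forces a unitary in `𝒮₂` to send each sufficiently deep
`S_α` to a single `S_β` (`tame_of_isometry`, `exists_thompson_mul_word`): `𝒮₂` acts by prefix
replacement.

Restriction. An automorphism `a = λ_w` clearly preserves finite sums; the difficulty is `a⁻¹`.
Approximate `a⁻¹(x)` in norm by a linear combination `y` of terms `S_α S_β*`. Each `a(S_α S_β*)` is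
tame, so inside any cylinder there is a smaller one, `ρ`, that each of them either fixes or moves
off itself. If it fixes `S_ρ`, then `S_α S_β*` fixes the isometry `a⁻¹(S_ρ)`; a nontrivial prefix
replacement fixes at most one point, too little for the range of an isometry, so `α = β`
(`eq_of_word_mul_star_mul_eq`). Hence, under `a(P_γ)` with `γ` long, the compression of `a(y)` is a
scalar depending on `γ` alone. For `x = P_μ` it is within `1/2` of each value that `P_μ` takes
there, so `P_μ` is constantly `0` or `1` under `a(P_γ)`, and `a⁻¹(P_μ)` is a finite sum. The
generators follow by a similar estimate.

Inner automorphisms. Conjugation by `u` is `λ_w` with `w = u φ(u*)`, where `φ(x) = ∑ S_i x S_i*`.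

Simplicity. Swaps of disjoint cylinders generate `𝒮₂` (`eq_top_of_forall_swap_mem`), and Higman's
double commutator trick puts every swap into each nontrivial normal subgroup (`forall_swap_mem`).
Almost simplicity is then witnessed by `H = 𝒮₂`. -/

/-- Neither of two words is a prefix of the other. -/
def Perp (a b : List (Fin 2)) : Prop := ¬ a <+: b ∧ ¬ b <+: a

lemma Perp.symm {a b : List (Fin 2)} (h : Perp a b) : Perp b a := ⟨h.2, h.1⟩

lemma Perp.append {a b : List (Fin 2)} (h : Perp a b) (x y : List (Fin 2)) :
    Perp (a ++ x) (b ++ y) := by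
  have key : ∀ {a b : List (Fin 2)}, Perp a b → ∀ x y, ¬ a ++ x <+: b ++ y := by
    intro a b h x y hp
    have h1 : a <+: b ++ y := (List.prefix_append a x).trans hp
    rcases List.prefix_or_prefix_of_prefix h1 (List.prefix_append b y) with h2 | h2
    · exact h.1 h2
    · exact h.2 h2
  exact ⟨key h x y, key h.symm y x⟩

lemma Perp.append_left {a b : List (Fin 2)} (h : Perp a b) (x : List (Fin 2)) :
    Perp (a ++ x) b := by
  simpa using h.append x []

lemma Perp.append_right {a b : List (Fin 2)} (h : Perp a b) (x : List (Fin 2)) :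
    Perp a (b ++ x) := by
  simpa using h.append [] x

lemma perp_cons_cons_self {i : Fin 2} {a b : List (Fin 2)} :
    Perp (i :: a) (i :: b) ↔ Perp a b := by
  simp [Perp]

lemma perp_cons_of_ne {i j : Fin 2} (hij : i ≠ j) (a b : List (Fin 2)) :
    Perp (i :: a) (j :: b) := by
  simp [Perp, hij, hij.symm]

lemma perp_append_append_self (c : List (Fin 2)) {a b : List (Fin 2)} (h : Perp a b) :
    Perp (c ++ a) (c ++ b) := by
  induction c with
  | nil => exact h
  | cons i c ih => exact perp_cons_cons_self.2 ih

lemma prefix_or_prefix_or_perp (a b : List (Fin 2)) : a <+: b ∨ b <+: a ∨ Perp a b := by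
  by_cases h1 : a <+: b
  · exact Or.inl h1
  · by_cases h2 : b <+: a
    · exact Or.inr (Or.inl h2)
    · exact Or.inr (Or.inr ⟨h1, h2⟩)

lemma fin_two_add_one_ne (i : Fin 2) : i + 1 ≠ i := by
  revert i; decide

lemma fin_two_eq_or (i j : Fin 2) : j = i ∨ j = i + 1 := by
  revert i j; decide

/-- A word `z` longer than `a` can follow at most one of the two continuations of `a`. So a single
letter suffices to leave the path to `z`. -/
lemma exists_append_singleton_perp {a z : List (Fin 2)} (h : a.length < z.length) :
    ∃ x, Perp z (a ++ [x]) := by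
  by_cases hp : a <+: z
  · obtain ⟨t, rfl⟩ := hp
    cases t with
    | nil => simp at h
    | cons i t =>
      exact ⟨i + 1, perp_append_append_self a (perp_cons_of_ne (fin_two_add_one_ne i).symm _ _)⟩
  · have hp' : ¬ z <+: a := fun h' => absurd h'.length_le (by omega)
    exact ⟨0, Perp.append_right ⟨hp', hp⟩ _⟩

/-! ### Isometries and words in the generators -/

section
variable {A : Type u} [CStarAlgebra A] {S : Fin 2 → A}

/-- Expanding `(y - x)*(y - x)` gives `1 - 1 - 1 + 1 = 0`. -/
lemma eq_of_isometry {x y : A} (hx : star x * x = 1) (hy : star y * y = 1)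
    (h : star x * y = 1) : y = x := by
  have h' : star y * x = 1 := by simpa using congrArg star h
  rw [← sub_eq_zero, ← CStarRing.star_mul_self_eq_zero_iff]
  simp [sub_mul, mul_sub, hx, hy, h, h']

lemma norm_of_isometry [Nontrivial A] {x : A} (hx : star x * x = 1) : ‖x‖ = 1 := by
  have h := CStarRing.norm_star_mul_self (x := x)
  rw [hx, CStarRing.norm_one] at h
  nlinarith [norm_nonneg x]

namespace IsCuntzPair

lemma star_word_mul_self (hS : IsCuntzPair S) (a : List (Fin 2)) :
    star (word S a) * word S a = 1 := by
  induction a with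
  | nil => simp [word_nil]
  | cons i a ih =>
    rw [word_cons, star_mul, mul_assoc, ← mul_assoc (star (S i)), hS.isometry, one_mul, ih]

lemma star_word_mul_self_assoc (hS : IsCuntzPair S) (a : List (Fin 2)) (x : A) :
    star (word S a) * (word S a * x) = x := by
  rw [← mul_assoc, hS.star_word_mul_self, one_mul]

lemma star_word_mul_append (hS : IsCuntzPair S) (a b : List (Fin 2)) :
    star (word S a) * word S (a ++ b) = word S b := by
  rw [word_append, hS.star_word_mul_self_assoc]

lemma star_word_append_mul (hS : IsCuntzPair S) (a b : List (Fin 2)) :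
    star (word S (a ++ b)) * word S a = star (word S b) := by
  simpa using congrArg star (hS.star_word_mul_append a b)

lemma star_word_mul_of_perp (hS : IsCuntzPair S) {a b : List (Fin 2)} (h : Perp a b) :
    star (word S a) * word S b = 0 := by
  induction a generalizing b with
  | nil => exact absurd List.nil_prefix h.1
  | cons i a ih =>
    cases b with
    | nil => exact absurd List.nil_prefix h.2
    | cons j b =>
      have hx : star (word S (i :: a)) * word S (j :: b)
          = star (word S a) * (star (S i) * S j) * word S b := by
        simp only [word_cons, star_mul, mul_assoc]
      rw [hx]
      by_cases hij : i = j
      · subst hij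
        simp [hS.isometry, ih (perp_cons_cons_self.1 h)]
      · simp [hS.orthogonal hij]

lemma star_word_mul_of_perp_assoc (hS : IsCuntzPair S) {a b : List (Fin 2)} (h : Perp a b)
    (x : A) : star (word S a) * (word S b * x) = 0 := by
  rw [← mul_assoc, hS.star_word_mul_of_perp h, zero_mul]

lemma sum_word_append (hS : IsCuntzPair S) (a : List (Fin 2)) :
    word S a * star (word S a) = word S (a ++ [0]) * star (word S (a ++ [0])) +
      word S (a ++ [1]) * star (word S (a ++ [1])) := by
  have h := hS.sum_range
  rw [Fin.sum_univ_two] at h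
  calc word S a * star (word S a)
      = word S a * (S 0 * star (S 0) + S 1 * star (S 1)) * star (word S a) := by
        rw [h, mul_one]
    _ = _ := by
        simp only [word_append, word_cons, word_nil, mul_one, star_mul, mul_add, add_mul,
          mul_assoc]

/-- Membership of `x` in an additive submonoid can be checked after cutting down to all the
cylinders of a given depth. -/
lemma mem_of_forall_mul_mem (hS : IsCuntzPair S) (B : AddSubmonoid A) {x : A} (n : ℕ)
    (h : ∀ a : List (Fin 2), a.length = n → x * (word S a * star (word S a)) ∈ B) : x ∈ B := by
  induction n with
  | zero => simpa [word_nil] using h [] rfl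
  | succ n ih =>
    refine ih fun a ha => ?_
    rw [hS.sum_word_append, mul_add]
    exact add_mem (h _ (by simp [ha])) (h _ (by simp [ha]))

lemma eq_of_forall_mul_word (hS : IsCuntzPair S) {x y : A} (n : ℕ)
    (h : ∀ a : List (Fin 2), a.length = n → x * word S a = y * word S a) : x = y := by
  have : x - y ∈ (⊥ : AddSubmonoid A) := by
    refine hS.mem_of_forall_mul_mem ⊥ n fun a ha => ?_
    rw [AddSubmonoid.mem_bot, ← mul_assoc, sub_mul, h a ha, sub_self, zero_mul]
  exact sub_eq_zero.1 (by simpa using this)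

variable [Nontrivial A]

lemma word_ne_zero (hS : IsCuntzPair S) (a : List (Fin 2)) : word S a ≠ 0 := fun h => by
  have := hS.star_word_mul_self a
  simp [h] at this

lemma norm_word (hS : IsCuntzPair S) (a : List (Fin 2)) : ‖word S a‖ = 1 :=
  norm_of_isometry (hS.star_word_mul_self a)

lemma perp_of_star_word_mul (hS : IsCuntzPair S) {a b : List (Fin 2)}
    (h : star (word S a) * word S b = 0) : Perp a b := by
  constructor
  · rintro ⟨t, rfl⟩
    rw [hS.star_word_mul_append] at h
    exact hS.word_ne_zero t h
  · rintro ⟨t, rfl⟩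
    rw [hS.star_word_append_mul] at h
    exact hS.word_ne_zero t (star_eq_zero.1 h)

lemma eq_nil_of_word_eq_one (hS : IsCuntzPair S) {a : List (Fin 2)} (h : word S a = 1) :
    a = [] := by
  cases a with
  | nil => rfl
  | cons i a =>
    have h1 := hS.star_word_mul_of_perp (perp_cons_of_ne (fin_two_add_one_ne i) [] a)
    rw [h, mul_one, star_eq_zero] at h1
    exact absurd h1 (hS.word_ne_zero _)

lemma word_injective (hS : IsCuntzPair S) : Function.Injective (word S) := by
  intro a b h
  have h1 : star (word S a) * word S b = 1 := by rw [← h, hS.star_word_mul_self]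
  rcases prefix_or_prefix_or_perp a b with ⟨t, rfl⟩ | ⟨t, rfl⟩ | hp
  · rw [hS.star_word_mul_append] at h1
    simp [hS.eq_nil_of_word_eq_one h1]
  · rw [hS.star_word_append_mul] at h1
    simp [hS.eq_nil_of_word_eq_one (show word S t = 1 by simpa using congrArg star h1)]
  · rw [hS.star_word_mul_of_perp hp] at h1
    exact absurd h1 zero_ne_one

end IsCuntzPair

/-! ### Local action on cylinders, and positivity of finite sums -/

/-- `f` maps every cylinder of some fixed depth to `0` or, by prefix replacement, to a cylinder. -/
def Tame (S : Fin 2 → A) (f : A) : Prop :=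
  ∃ n, ∀ a : List (Fin 2), n ≤ a.length → f * word S a = 0 ∨ ∃ b, f * word S a = word S b

lemma Tame.of_length_eq {f : A} (n : ℕ)
    (h : ∀ a : List (Fin 2), a.length = n → f * word S a = 0 ∨ ∃ b, f * word S a = word S b) :
    Tame S f := by
  refine ⟨n, fun a ha => ?_⟩
  rw [← List.take_append_drop n a, word_append, ← mul_assoc]
  rcases h (a.take n) (by simp [ha]) with h0 | ⟨b, hb⟩
  · exact Or.inl (by simp [h0])
  · exact Or.inr ⟨b ++ a.drop n, by rw [hb, word_append]⟩

lemma Tame.mul {f g : A} (hf : Tame S f) (hg : Tame S g) : Tame S (f * g) := by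
  obtain ⟨n, hn⟩ := hf
  obtain ⟨m, hm⟩ := hg
  refine Tame.of_length_eq (m + n) fun a ha => ?_
  have key : g * word S a = 0 ∨ ∃ b, n ≤ b.length ∧ g * word S a = word S b := by
    rw [← List.take_append_drop m a, word_append, ← mul_assoc]
    rcases hm (a.take m) (by simp [ha]) with h0 | ⟨b, hb⟩
    · exact Or.inl (by simp [h0])
    · exact Or.inr ⟨b ++ a.drop m, by simp; omega, by rw [hb, word_append]⟩
  rcases key with h0 | ⟨b, hb, h⟩
  · exact Or.inl (by rw [mul_assoc, h0, mul_zero])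
  · rw [mul_assoc, h]
    exact hn b hb

lemma Tame.one : Tame S (1 : A) := ⟨0, fun a _ => Or.inr ⟨a, one_mul _⟩⟩

lemma tame_word (a : List (Fin 2)) : Tame S (word S a) :=
  ⟨0, fun b _ => Or.inr ⟨a ++ b, (word_append S a b).symm⟩⟩

lemma IsCuntzPair.tame_star_word (hS : IsCuntzPair S) (a : List (Fin 2)) :
    Tame S (star (word S a)) := by
  refine ⟨a.length, fun b hb => ?_⟩
  rcases prefix_or_prefix_or_perp a b with ⟨t, rfl⟩ | h | h
  · exact Or.inr ⟨t, hS.star_word_mul_append a t⟩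
  · obtain rfl := h.eq_of_length (le_antisymm h.length_le hb)
    exact Or.inr ⟨[], by rw [hS.star_word_mul_self, word_nil]⟩
  · exact Or.inl (hS.star_word_mul_of_perp h)

lemma IsCuntzPair.mem_wordSums_of_tame (hS : IsCuntzPair S) {f : A} (hf : Tame S f) :
    f ∈ wordSums S := by
  obtain ⟨n, hn⟩ := hf
  refine hS.mem_of_forall_mul_mem _ n fun a ha => ?_
  rw [← mul_assoc]
  rcases hn a ha.ge with h | ⟨b, h⟩
  · simp [h]
  · rw [h]
    exact wordPair_mem S b a

lemma Tame.exists_common {ι : Type*} (s : Finset ι) {f : ι → A} (hf : ∀ i, Tame S (f i)) :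
    ∃ n, ∀ i ∈ s, ∀ a : List (Fin 2), n ≤ a.length →
      f i * word S a = 0 ∨ ∃ b, f i * word S a = word S b := by
  choose n hn using hf
  exact ⟨s.sup n, fun i hi a ha => hn i a ((Finset.le_sup hi).trans ha)⟩

/-- `f` either moves the cylinder of `a` off itself, or fixes it pointwise. -/
def Decides (S : Fin 2 → A) (f : A) (a : List (Fin 2)) : Prop :=
  star (word S a) * f * word S a = 0 ∨ f * word S a = word S a

lemma Decides.append {f : A} {a : List (Fin 2)} (h : Decides S f a) (b : List (Fin 2)) :
    Decides S f (a ++ b) := by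
  rcases h with h | h
  · left
    have : star (word S (a ++ b)) * f * word S (a ++ b)
        = star (word S b) * (star (word S a) * f * word S a) * word S b := by
      simp only [word_append, star_mul, mul_assoc]
    rw [this, h, mul_zero, zero_mul]
  · right
    rw [word_append, ← mul_assoc, h]

/-- On a deep subcylinder `r`, a tame `f` is `0` or replaces `r` by some `c`. The cases `c = r` and
`c` disjoint from `r` are immediate. If one properly extends the other, with first extra letter `i`,
then the half `r(i+1)` is moved off itself. -/
lemma IsCuntzPair.exists_decides (hS : IsCuntzPair S) {f : A} (hf : Tame S f)
    (a : List (Fin 2)) : ∃ b, Decides S f (a ++ b) := by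
  obtain ⟨n, hn⟩ := hf
  suffices H : ∃ b, Decides S f ((a ++ List.replicate n 0) ++ b) by
    obtain ⟨b, hb⟩ := H
    exact ⟨List.replicate n 0 ++ b, by rwa [← List.append_assoc]⟩
  have hlen : n ≤ (a ++ List.replicate n (0 : Fin 2)).length := by simp
  generalize a ++ List.replicate n 0 = r at hlen
  rcases hn r hlen with h | ⟨c, h⟩
  · exact ⟨[], Or.inl (by rw [List.append_nil, mul_assoc, h, mul_zero])⟩
  rcases prefix_or_prefix_or_perp r c with ⟨t, rfl⟩ | ⟨t, rfl⟩ | hp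
  · cases t with
    | nil => exact ⟨[], Or.inr (by simpa using h)⟩
    | cons i t =>
      refine ⟨[i + 1], Or.inl ?_⟩
      rw [mul_assoc, word_append S r [i + 1], ← mul_assoc f, h, ← word_append, ← word_append,
        List.append_assoc]
      exact hS.star_word_mul_of_perp (perp_append_append_self _
        (perp_cons_of_ne (fin_two_add_one_ne i) _ _))
  · cases t with
    | nil => exact ⟨[], Or.inr (by simpa using h)⟩
    | cons i t =>
      refine ⟨[i + 1], Or.inl ?_⟩
      rw [mul_assoc, word_append S (c ++ i :: t) [i + 1], ← mul_assoc f, h, ← word_append,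
        ← word_append, List.append_assoc]
      exact hS.star_word_mul_of_perp (perp_append_append_self _
        (perp_cons_of_ne (fin_two_add_one_ne i).symm _ _))
  · exact ⟨[], Or.inl (by rw [List.append_nil, mul_assoc, h, hS.star_word_mul_of_perp hp])⟩

lemma IsCuntzPair.exists_forall_decides (hS : IsCuntzPair S) {ι : Type*} (s : Finset ι)
    {f : ι → A} (hf : ∀ i, Tame S (f i)) (a : List (Fin 2)) :
    ∃ b, ∀ i ∈ s, Decides S (f i) (a ++ b) := by
  classical
  induction s using Finset.induction_on with
  | empty => exact ⟨[], by simp⟩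
  | insert j s _ ih =>
    obtain ⟨b, hb⟩ := ih
    obtain ⟨c, hc⟩ := hS.exists_decides (hf j) (a ++ b)
    refine ⟨b ++ c, fun i hi => ?_⟩
    rw [← List.append_assoc]
    rcases Finset.mem_insert.1 hi with rfl | hi
    · exact hc
    · exact (hb i hi).append c

/-- Once decided, each term `S_α S_β*` compresses to `0` or `1`, and shrinking the cylinder further
keeps a scalar compression unchanged. The number `n` counts the terms that fix the cylinder. -/
lemma IsCuntzPair.exists_compression_eq_natCast (hS : IsCuntzPair S) {r : A}
    (hr : r ∈ wordSums S) (a : List (Fin 2)) :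
    ∃ (b : List (Fin 2)) (n : ℕ), star (word S (a ++ b)) * r * word S (a ++ b) = n := by
  induction hr using AddSubmonoid.closure_induction generalizing a with
  | zero => exact ⟨[], 0, by simp⟩
  | mem x hx =>
    obtain ⟨p, rfl⟩ := hx
    obtain ⟨b, hb | hb⟩ := hS.exists_decides ((tame_word p.1).mul (hS.tame_star_word p.2)) a
    · exact ⟨b, 0, by simpa using hb⟩
    · exact ⟨b, 1, by dsimp only; rw [mul_assoc, hb, hS.star_word_mul_self, Nat.cast_one]⟩
  | add x y _ _ hx hy =>
    obtain ⟨b, n, hb⟩ := hx a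
    obtain ⟨c, m, hc⟩ := hy (a ++ b)
    refine ⟨b ++ c, n + m, ?_⟩
    rw [mul_add, add_mul, ← List.append_assoc, hc, word_append S (a ++ b) c, star_mul]
    have : star (word S c) * star (word S (a ++ b)) * x * (word S (a ++ b) * word S c)
        = star (word S c) * (star (word S (a ++ b)) * x * word S (a ++ b)) * word S c := by
      simp only [mul_assoc]
    rw [this, hb, mul_assoc, Nat.cast_comm, hS.star_word_mul_self_assoc]
    simp

lemma exists_mul_word_eq_sum {f : A} (hS : IsCuntzPair S) (hf : f ∈ wordSums S) :
    ∃ n, ∀ a : List (Fin 2), n ≤ a.length →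
      ∃ l : List (List (Fin 2)), f * word S a = (l.map (word S)).sum := by
  induction hf using AddSubmonoid.closure_induction with
  | zero => exact ⟨0, fun a _ => ⟨[], by simp⟩⟩
  | mem x hx =>
    obtain ⟨p, rfl⟩ := hx
    obtain ⟨n, hn⟩ := (tame_word p.1).mul (hS.tame_star_word p.2)
    refine ⟨n, fun a ha => ?_⟩
    rcases hn a ha with h | ⟨b, h⟩
    · exact ⟨[], by simpa using h⟩
    · exact ⟨[b], by simpa using h⟩
  | add x y _ _ hx hy =>
    obtain ⟨n, hn⟩ := hx
    obtain ⟨m, hm⟩ := hy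
    refine ⟨n + m, fun a ha => ?_⟩
    obtain ⟨l, hl⟩ := hn a (by omega)
    obtain ⟨k, hk⟩ := hm a (by omega)
    exact ⟨l ++ k, by simp [add_mul, hl, hk]⟩

lemma IsCuntzPair.word_mem_wordSums (S : Fin 2 → A) (a : List (Fin 2)) :
    word S a ∈ wordSums S := by
  simpa [word_nil] using wordPair_mem S a []

variable [Nontrivial A]

lemma IsCuntzPair.neg_one_notMem_wordSums (hS : IsCuntzPair S) : (-1 : A) ∉ wordSums S := by
  intro h
  obtain ⟨b, n, hb⟩ := hS.exists_compression_eq_natCast h []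
  rw [mul_neg, mul_one, neg_mul, hS.star_word_mul_self] at hb
  have h1 : ((n + 1 : ℕ) : A) = 0 := by rw [Nat.cast_add, ← hb]; simp
  have h2 : algebraMap ℂ A ((n + 1 : ℕ) : ℂ) = algebraMap ℂ A 0 := by
    rw [map_natCast, h1, map_zero]
  have h3 := (algebraMap ℂ A).injective h2
  exact absurd h3 (Nat.cast_ne_zero.2 n.succ_ne_zero)

/-- If `f S_a` were a sum of two or more words, expanding `(f S_a)*(f S_a) = 1` would produce `1 +
1` plus finite sums, making `-1` a finite sum. -/
lemma IsCuntzPair.tame_of_isometry (hS : IsCuntzPair S) {f : A} (hf : f ∈ wordSums S)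
    (hf1 : star f * f = 1) : Tame S f := by
  obtain ⟨n, hn⟩ := exists_mul_word_eq_sum hS hf
  refine ⟨n, fun a ha => ?_⟩
  obtain ⟨l, hl⟩ := hn a ha
  rcases l with _ | ⟨b, _ | ⟨c, l⟩⟩
  · exact Or.inl (by simpa using hl)
  · exact Or.inr ⟨b, by simpa using hl⟩
  · exfalso
    set x := word S b with hx
    set y := word S c with hy
    set z := (l.map (word S)).sum with hz
    have hxm : x ∈ wordSums S := word_mem_wordSums S b
    have hym : y ∈ wordSums S := word_mem_wordSums S c
    have hzm : z ∈ wordSums S := by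
      refine AddSubmonoid.list_sum_mem _ fun t ht => ?_
      obtain ⟨d, _, rfl⟩ := List.mem_map.1 ht
      exact word_mem_wordSums S d
    have h1 : star (f * word S a) * (f * word S a) = 1 := by
      rw [star_mul, mul_assoc, ← mul_assoc (star f), hf1, one_mul, hS.star_word_mul_self]
    have hsum : f * word S a = x + (y + z) := by rw [hl]; simp [hx, hy, hz]
    have hxx : star x * x = 1 := hS.star_word_mul_self b
    have hyy : star y * y = 1 := hS.star_word_mul_self c
    have hneg : (-1 : A) = star x * y + star x * z + star y * x + star y * z
        + star z * x + star z * y + star z * z := by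
      rw [hsum] at h1
      simp only [star_add, add_mul, mul_add, hxx, hyy] at h1
      have : (0 : A) = 1 - 1 := by simp
      rw [← sub_eq_zero] at h1 ⊢
      rw [← neg_eq_zero, ← h1]
      abel
    refine hS.neg_one_notMem_wordSums ?_
    rw [hneg]
    have hxs := star_mem_wordSums S hxm
    have hys := star_mem_wordSums S hym
    have hzs := star_mem_wordSums S hzm
    exact add_mem (add_mem (add_mem (add_mem (add_mem (add_mem (hS.mul_mem_wordSums hxs hym)
      (hS.mul_mem_wordSums hxs hzm)) (hS.mul_mem_wordSums hys hxm)) (hS.mul_mem_wordSums hys hzm))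
      (hS.mul_mem_wordSums hzs hxm)) (hS.mul_mem_wordSums hzs hym)) (hS.mul_mem_wordSums hzs hzm)

lemma IsCuntzPair.tame_of_mem_thompson (hS : IsCuntzPair S) {w : unitary A}
    (hw : w ∈ thompson S hS) : Tame S (w : A) :=
  hS.tame_of_isometry hw (Unitary.coe_star_mul_self w)

lemma IsCuntzPair.exists_thompson_mul_word (hS : IsCuntzPair S) {w : unitary A}
    (hw : w ∈ thompson S hS) :
    ∃ n, ∀ a : List (Fin 2), n ≤ a.length → ∃ b, (w : A) * word S a = word S b := by
  obtain ⟨n, hn⟩ := hS.tame_of_mem_thompson hw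
  refine ⟨n, fun a ha => (hn a ha).resolve_left fun h => hS.word_ne_zero a ?_⟩
  rw [← one_mul (word S a), ← Unitary.coe_star_mul_self w, mul_assoc, h, mul_zero]

end
end Cuntz
-- Density of linear combinations, and rigidity of prefix replacements
namespace Cuntz
section
variable {A : Type u} [CStarAlgebra A] {S : Fin 2 → A}

namespace IsCuntzPair

lemma mem_closure_span (hS : IsCuntzPair S) (x : A) :
    x ∈ closure (Submodule.span ℂ (Set.range fun p : List (Fin 2) × List (Fin 2) =>
      word S p.1 * star (word S p.2)) : Set A) := by
  set M := Submodule.span ℂ (Set.range fun p : List (Fin 2) × List (Fin 2) =>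
      word S p.1 * star (word S p.2)) with hM
  have hsub : ∀ y ∈ wordSums S, y ∈ M := fun y hy =>
    (AddSubmonoid.closure_le (S := M.toAddSubmonoid)).2 Submodule.subset_span hy
  have hmul : ∀ y ∈ M, ∀ z ∈ M, y * z ∈ M := by
    intro y hy z hz
    have hyz : y * z ∈ M * M := Submodule.mul_mem_mul hy hz
    rw [hM, Submodule.span_mul_span] at hyz
    refine Submodule.span_le.2 ?_ hyz
    rintro _ ⟨_, ⟨p, rfl⟩, _, ⟨q, rfl⟩, rfl⟩
    exact hsub _ (hS.mul_mem_wordSums (wordPair_mem S _ _) (wordPair_mem S _ _))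
  have hstar : ∀ y ∈ M, star y ∈ M := by
    intro y hy
    induction hy using Submodule.span_induction with
    | mem y hy =>
      obtain ⟨p, rfl⟩ := hy
      exact hsub _ (star_mem_wordSums S (wordPair_mem S _ _))
    | zero => simp
    | add y z _ _ hy hz => rw [star_add]; exact add_mem hy hz
    | smul c y _ hy => rw [star_smul]; exact M.smul_mem _ hy
  have hadj : ∀ y ∈ StarAlgebra.adjoin ℂ (Set.range S), y ∈ M := by
    intro y hy
    induction hy using StarAlgebra.adjoin_induction with
    | mem y hy =>
      obtain ⟨i, rfl⟩ := hy
      refine hsub _ ?_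
      simpa [word_cons, word_nil] using word_mem_wordSums S [i]
    | algebraMap r =>
      rw [Algebra.algebraMap_eq_smul_one]
      exact M.smul_mem _ (hsub _ (one_mem_wordSums S))
    | add y z _ _ hy hz => exact add_mem hy hz
    | mul y z _ _ hy hz => exact hmul y hy z hz
    | star y _ hy => exact hstar y hy
  have hx : x ∈ (StarAlgebra.adjoin ℂ (Set.range S)).topologicalClosure := by
    rw [hS.generates]; trivial
  rw [← SetLike.mem_coe, StarSubalgebra.topologicalClosure_coe] at hx
  exact closure_mono hadj hx

lemma exists_finsupp_norm_sub_lt (hS : IsCuntzPair S) (x : A) {ε : ℝ} (hε : 0 < ε) :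
    ∃ c : List (Fin 2) × List (Fin 2) →₀ ℂ,
      ‖x - ∑ p ∈ c.support, c p • (word S p.1 * star (word S p.2))‖ < ε := by
  obtain ⟨y, hy, hxy⟩ := Metric.mem_closure_iff.1 (hS.mem_closure_span x) ε hε
  obtain ⟨c, rfl⟩ := Finsupp.mem_span_range_iff_exists_finsupp.1 hy
  exact ⟨c, by rwa [dist_eq_norm] at hxy⟩

/-- Finitely many tame elements cannot all send the cylinder of `a` into one tiny cylinder `z`: the
word `b` spends one letter per element to steer its image away from `z`. Note that `a` and `m` do
not depend on `z`. -/
lemma exists_forall_star_word_mul_eq_zero (hS : IsCuntzPair S) {ι : Type*} (s : Finset ι)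
    {f : ι → A} (hf : ∀ i, Tame S (f i)) :
    ∃ (a : List (Fin 2)) (m : ℕ), ∀ z : List (Fin 2), m ≤ z.length → ∃ b,
      ∀ i ∈ s, star (word S z) * f i * word S (a ++ b) = 0 := by
  classical
  obtain ⟨n, hn⟩ := Tame.exists_common s hf
  have ha : n ≤ (List.replicate n (0 : Fin 2)).length := by simp
  generalize List.replicate n (0 : Fin 2) = a at ha
  replace hn := fun i hi => hn i hi a ha
  suffices H : ∀ t ⊆ s, ∃ m : ℕ, ∀ z : List (Fin 2), m ≤ z.length →
      ∃ b, b.length = t.card ∧ ∀ i ∈ t, star (word S z) * f i * word S (a ++ b) = 0 by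
    obtain ⟨m, hm⟩ := H s subset_rfl
    exact ⟨a, m, fun z hz => (hm z hz).imp fun b hb => hb.2⟩
  intro t
  induction t using Finset.induction_on with
  | empty => exact fun _ => ⟨0, fun z _ => ⟨[], by simp⟩⟩
  | insert j t hj ih =>
    intro hts
    obtain ⟨m, hm⟩ := ih ((Finset.subset_insert j t).trans hts)
    have hstep : ∀ z b : List (Fin 2), (∀ i ∈ t, star (word S z) * f i * word S (a ++ b) = 0) →
        ∀ x, ∀ i ∈ t, star (word S z) * f i * word S (a ++ (b ++ [x])) = 0 := by
      intro z b h x i hi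
      rw [← List.append_assoc, word_append S (a ++ b), ← mul_assoc, h i hi, zero_mul]
    rcases hn j (hts (Finset.mem_insert_self j t)) with h0 | ⟨v, hv⟩
    · refine ⟨m, fun z hz => ?_⟩
      obtain ⟨b, hb, h⟩ := hm z hz
      refine ⟨b ++ [0], by simp [hb, hj], fun i hi => ?_⟩
      rcases Finset.mem_insert.1 hi with rfl | hi
      · rw [word_append, mul_assoc, ← mul_assoc (f i), h0, zero_mul, mul_zero]
      · exact hstep z b h 0 i hi
    -- The word `b` found so far has length `t.card`, so this bound makes `v ++ b` shorter than `z`,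
    -- leaving room for an escaping letter.
    · refine ⟨m + v.length + t.card + 1, fun z hz => ?_⟩
      obtain ⟨b, hb, h⟩ := hm z (by omega)
      obtain ⟨x, hx⟩ := exists_append_singleton_perp (a := v ++ b) (z := z) (by simp; omega)
      refine ⟨b ++ [x], by simp [hb, hj], fun i hi => ?_⟩
      rcases Finset.mem_insert.1 hi with rfl | hi
      · rw [word_append, mul_assoc, ← mul_assoc (f i), hv, ← word_append, ← List.append_assoc]
        exact hS.star_word_mul_of_perp hx
      · exact hstep z b h x i hi

variable [Nontrivial A]

/-- The range of an isometry is not contained in arbitrarily small cylinders. -/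
lemma not_forall_word_mul_star_mul_eq (hS : IsCuntzPair S) {r : A} (hr : star r * r = 1)
    (z : ℕ → List (Fin 2)) (hz : ∀ n, n ≤ (z n).length)
    (h : ∀ n, word S (z n) * (star (word S (z n)) * r) = r) : False := by
  obtain ⟨c, hc⟩ := hS.exists_finsupp_norm_sub_lt r one_pos
  obtain ⟨a, m, hm⟩ := hS.exists_forall_star_word_mul_eq_zero c.support
    (f := fun p : List (Fin 2) × List (Fin 2) => word S p.1 * star (word S p.2))
    (fun p => (tame_word p.1).mul (hS.tame_star_word p.2))
  obtain ⟨b, hb⟩ := hm (z m) (hz m)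
  set y := ∑ p ∈ c.support, c p • (word S p.1 * star (word S p.2)) with hy
  have h0 : star (word S (z m)) * y * word S (a ++ b) = 0 := by
    rw [hy, Finset.mul_sum, Finset.sum_mul]
    refine Finset.sum_eq_zero fun p hp => ?_
    rw [mul_smul_comm, smul_mul_assoc, hb p hp, smul_zero]
  have h1 : star (star (word S (z m)) * r * word S (a ++ b)) *
      (star (word S (z m)) * r * word S (a ++ b)) = 1 := by
    calc _ = star (word S (a ++ b)) * (star r * (word S (z m) * (star (word S (z m)) * r))) *
        word S (a ++ b) := by simp only [star_mul, star_star, mul_assoc]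
      _ = 1 := by rw [h, hr, mul_one, hS.star_word_mul_self]
  have h2 : star (word S (z m)) * r * word S (a ++ b)
      = star (word S (z m)) * (r - y) * word S (a ++ b) := by
    rw [mul_sub, sub_mul, h0, sub_zero]
  have h3 := norm_of_isometry h1
  rw [h2] at h3
  -- The compression of `r` is an isometry, of norm `1`, while that of `y` vanishes; yet `r` and `y`
  -- are less than `1` apart.
  have h4 : ‖star (word S (z m)) * (r - y) * word S (a ++ b)‖ ≤ ‖r - y‖ := by
    refine (norm_mul_le _ _).trans ?_
    rw [hS.norm_word, mul_one]
    refine (norm_mul_le _ _).trans ?_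
    rw [norm_star, hS.norm_word, one_mul]
  linarith

/-- Iterating, `r` has range in the cylinders of `a, aa, aaa, …`, which shrink to a point when `a`
is nonempty. -/
lemma eq_nil_of_word_mul_eq (hS : IsCuntzPair S) {r : A} (hr : star r * r = 1)
    {a : List (Fin 2)} (h : word S a * r = r) : a = [] := by
  by_contra ha
  have hpow : ∀ n, word S (List.replicate n a).flatten * r = r := by
    intro n
    induction n with
    | zero => simp [word_nil]
    | succ n ih => rw [List.replicate_succ, List.flatten_cons, word_append, mul_assoc, ih, h]
  refine hS.not_forall_word_mul_star_mul_eq hr (fun n => (List.replicate n a).flatten)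
    (fun n => ?_) (fun n => ?_)
  · have : 1 ≤ a.length := List.length_pos_iff.2 ha
    simp only [List.length_flatten, List.map_replicate, List.sum_replicate, smul_eq_mul]
    nlinarith
  · have h2 : star (word S (List.replicate n a).flatten) * r = r := by
      conv_lhs => rw [← hpow n]
      rw [hS.star_word_mul_self_assoc]
    change word S (List.replicate n a).flatten *
      (star (word S (List.replicate n a).flatten) * r) = r
    rw [h2, hpow]

/-- Both cylinders contain the nonzero range of `r`, so the words are comparable. If `b = a ++ t`,
then `S_t` fixes the isometry `S_a* r`, hence `t` is empty. -/
lemma eq_of_star_word_mul_eq (hS : IsCuntzPair S) {r : A} (hr : star r * r = 1)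
    {a b : List (Fin 2)} (ha : word S a * (star (word S a) * r) = r)
    (hb : word S b * (star (word S b) * r) = r)
    (h : star (word S a) * r = star (word S b) * r) : a = b := by
  have main : ∀ {a b : List (Fin 2)}, word S a * (star (word S a) * r) = r →
      word S b * (star (word S b) * r) = r →
      star (word S a) * r = star (word S b) * r → a <+: b → a = b := by
    rintro a _ ha hb h ⟨t, rfl⟩
    have h1 : star (star (word S a) * r) * (star (word S a) * r) = 1 := by
      rw [star_mul, star_star, mul_assoc, ha, hr]
    have h2 : word S t * (star (word S a) * r) = star (word S a) * r := by
      nth_rewrite 1 [h]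
      nth_rewrite 2 [← hb]
      rw [word_append S a t, mul_assoc (word S a), hS.star_word_mul_self_assoc]
    simp [hS.eq_nil_of_word_mul_eq h1 h2]
  rcases prefix_or_prefix_or_perp a b with hp | hp | hp
  · exact main ha hb h hp
  · exact (main hb ha h.symm hp).symm
  · have h0 : r = 0 := by
      rw [← ha, ← hb, hS.star_word_mul_of_perp_assoc hp, mul_zero]
    simp [h0] at hr

/-- A prefix replacement that fixes the range of an isometry is trivial there. -/
lemma eq_of_word_mul_star_mul_eq (hS : IsCuntzPair S) {r : A} (hr : star r * r = 1)
    {a b : List (Fin 2)} (h : word S a * (star (word S b) * r) = r) :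
    a = b ∧ word S a * (star (word S a) * r) = r := by
  have ha : word S a * (star (word S a) * r) = r := by
    nth_rewrite 2 [← h]
    nth_rewrite 1 [← h]
    rw [hS.star_word_mul_self_assoc, h]
  have hab : star (word S a) * r = star (word S b) * r := by
    nth_rewrite 1 [← h]
    rw [hS.star_word_mul_self_assoc]
  have hb : word S b * (star (word S b) * r) = r := by
    have h1 : star r * (word S b * (star (word S b) * r)) = 1 := by
      calc star r * (word S b * (star (word S b) * r))
          = star (star (word S b) * r) * (star (word S b) * r) := by
            simp only [star_mul, star_star, mul_assoc]
        _ = star r * (word S a * (star (word S a) * r)) := by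
            rw [← hab]
            simp only [star_mul, star_star, mul_assoc]
        _ = 1 := by rw [ha, hr]
    refine eq_of_isometry hr ?_ h1
    calc _ = star r * (word S b * (star (word S b) * (word S b * (star (word S b) * r)))) := by
          simp only [star_mul, star_star, mul_assoc]
      _ = 1 := by rw [hS.star_word_mul_self_assoc, h1]
  exact ⟨hS.eq_of_star_word_mul_eq hr ha hb hab, ha⟩

end IsCuntzPair
end
end Cuntz
-- The inverse of an automorphism `λ_w` preserves finite sums
namespace Cuntz
section
variable {A : Type u} [CStarAlgebra A] {S : Fin 2 → A}

lemma tame_map_word [Nontrivial A] {hS : IsCuntzPair S} {a : A ≃⋆ₐ[ℂ] A} (ha : a ∈ lambdaInv S hS)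
    (μ : List (Fin 2)) : Tame S (a (word S μ)) ∧ Tame S (a (star (word S μ))) := by
  obtain ⟨w, hw, h⟩ := ha
  have hS1 : ∀ i, word S [i] = S i := fun i => by simp [word_cons, word_nil]
  induction μ with
  | nil => simpa [word_nil] using Tame.one
  | cons i μ ih =>
    rw [word_cons, star_mul, map_mul, map_mul, map_star a (S i), h, star_mul]
    refine ⟨((hS.tame_of_mem_thompson hw).mul ?_).mul ih.1, ih.2.mul (Tame.mul ?_ ?_)⟩
    · rw [← hS1]; exact tame_word [i]
    · rw [← hS1]; exact hS.tame_star_word [i]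
    · exact hS.tame_of_mem_thompson (inv_mem hw)

lemma tame_map_wordPair [Nontrivial A] {hS : IsCuntzPair S} {a : A ≃⋆ₐ[ℂ] A}
    (ha : a ∈ lambdaInv S hS) (p : List (Fin 2) × List (Fin 2)) :
    Tame S (a (word S p.1 * star (word S p.2))) := by
  rw [map_mul]
  exact (tame_map_word ha p.1).1.mul (tame_map_word ha p.2).2

lemma mem_wordSums_map {hS : IsCuntzPair S} {a : A ≃⋆ₐ[ℂ] A}
    (ha : a ∈ lambdaInv S hS) {x : A} (hx : x ∈ wordSums S) : a x ∈ wordSums S := by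
  obtain ⟨w, hw, h⟩ := ha
  have hword : ∀ μ, a (word S μ) ∈ wordSums S := by
    intro μ
    induction μ with
    | nil => simpa [word_nil] using one_mem_wordSums S
    | cons i μ ih =>
      rw [word_cons, map_mul, h]
      refine hS.mul_mem_wordSums (hS.mul_mem_wordSums hw ?_) ih
      simpa [word_cons, word_nil] using IsCuntzPair.word_mem_wordSums S [i]
  induction hx using AddSubmonoid.closure_induction with
  | zero => simp
  | add x y _ _ hx hy => rw [map_add]; exact add_mem hx hy
  | mem x hx =>
    obtain ⟨p, rfl⟩ := hx
    dsimp only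
    rw [map_mul, map_star]
    exact hS.mul_mem_wordSums (hword _) (star_mem_wordSums S (hword _))

lemma Tame.exists_mul_word_eq_zero_or_self [Nontrivial A] (hS : IsCuntzPair S) {e : A}
    (he : Tame S e) (hstar : star e = e) (hidem : e * e = e) :
    ∃ n, ∀ μ : List (Fin 2), n ≤ μ.length → e * word S μ = 0 ∨ e * word S μ = word S μ := by
  obtain ⟨n, hn⟩ := he
  refine ⟨n, fun μ hμ => (hn μ hμ).imp_right ?_⟩
  rintro ⟨ν, hν⟩
  have h1 : star (word S μ) * word S ν = 1 := by
    rw [← hν]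
    calc star (word S μ) * (e * word S μ) = star (e * word S μ) * (e * word S μ) := by
          rw [star_mul, hstar, mul_assoc, ← mul_assoc e, hidem]
      _ = 1 := by rw [hν, hS.star_word_mul_self]
  rw [hν]
  exact eq_of_isometry (hS.star_word_mul_self μ) (hS.star_word_mul_self ν) h1

lemma norm_compression_sub_lt [Nontrivial A] (hS : IsCuntzPair S) (μ : List (Fin 2)) {x y : A}
    {ε : ℝ} (h : ‖x - y‖ < ε) :
    ‖star (word S μ) * x * word S μ - star (word S μ) * y * word S μ‖ < ε := by
  rw [← sub_mul, ← mul_sub]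
  refine lt_of_le_of_lt ((norm_mul_le _ _).trans ?_) h
  rw [hS.norm_word, mul_one]
  refine (norm_mul_le _ _).trans ?_
  rw [norm_star, hS.norm_word, one_mul]

lemma norm_map_eq (a : A ≃⋆ₐ[ℂ] A) (x : A) : ‖a x‖ = ‖x‖ :=
  NonUnitalStarAlgHom.norm_map a (EquivLike.injective a) x

lemma isometry_symm_word (hS : IsCuntzPair S) (a : A ≃⋆ₐ[ℂ] A) (ρ : List (Fin 2)) :
    star (a.symm (word S ρ)) * a.symm (word S ρ) = 1 := by
  rw [← map_star, ← map_mul, hS.star_word_mul_self, map_one]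

lemma eq_of_map_wordPair_mul_word [Nontrivial A] (hS : IsCuntzPair S) {a : A ≃⋆ₐ[ℂ] A}
    {p : List (Fin 2) × List (Fin 2)} {ρ : List (Fin 2)}
    (h : a (word S p.1 * star (word S p.2)) * word S ρ = word S ρ) :
    p.1 = p.2 ∧ word S p.1 * (star (word S p.1) * a.symm (word S ρ)) = a.symm (word S ρ) := by
  refine hS.eq_of_word_mul_star_mul_eq (isometry_symm_word hS a ρ) ?_
  have := congrArg a.symm h
  rwa [map_mul, StarAlgEquiv.symm_apply_apply, mul_assoc] at this

lemma prefix_of_word_mul_star_mul_eq (hS : IsCuntzPair S) {r : A} (hr : r ≠ 0)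
    {μ ν : List (Fin 2)} (hlen : μ.length ≤ ν.length)
    (hμ : word S μ * (star (word S μ) * r) = r) (hν : word S ν * (star (word S ν) * r) = r) :
    μ <+: ν := by
  rcases prefix_or_prefix_or_perp μ ν with hp | hp | hp
  · exact hp
  · rw [hp.eq_of_length (le_antisymm hp.length_le hlen)]
  · refine absurd ?_ hr
    rw [← hμ, ← hν, hS.star_word_mul_of_perp_assoc hp, mul_zero]

-- The point is that the right side does not involve `ρ`. A term survives only if it fixes `S_ρ`,
-- which forces `p.1 = p.2`; since `p.1` is no longer than `γ`, it is then a prefix of `γ`.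
-- Conversely, each such diagonal projection dominates `P_γ` and so contributes its coefficient.
open Classical in
lemma compression_map_sum [Nontrivial A] (hS : IsCuntzPair S) {a : A ≃⋆ₐ[ℂ] A}
    (c : List (Fin 2) × List (Fin 2) →₀ ℂ)
    {γ ρ : List (Fin 2)} (hγ : ∀ p ∈ c.support, p.1.length ≤ γ.length)
    (hdec : ∀ p ∈ c.support, Decides S (a (word S p.1 * star (word S p.2))) ρ)
    (hρ : a (word S γ * star (word S γ)) * word S ρ = word S ρ) :
    star (word S ρ) * a (∑ p ∈ c.support, c p • (word S p.1 * star (word S p.2))) * word S ρ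
      = algebraMap ℂ A (∑ p ∈ c.support with p.1 = p.2 ∧ p.1 <+: γ, c p) := by
  have hr : a.symm (word S ρ) ≠ 0 := by
    intro h0
    have := isometry_symm_word hS a ρ
    simp [h0] at this
  have hγr : word S γ * (star (word S γ) * a.symm (word S ρ)) = a.symm (word S ρ) :=
    (eq_of_map_wordPair_mul_word (p := (γ, γ)) hS hρ).2
  rw [map_sum, Finset.mul_sum, Finset.sum_mul, map_sum, Finset.sum_filter]
  refine Finset.sum_congr rfl fun p hp => ?_
  rw [map_smul, mul_smul_comm, smul_mul_assoc]
  rcases hdec p hp with h0 | h1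
  · rw [h0, smul_zero, if_neg]
    rintro ⟨h2, ⟨t, rfl⟩⟩
    rw [← h2] at h0
    have h3 : a (word S p.1 * star (word S p.1)) * word S ρ = word S ρ := by
      rw [← hρ, ← mul_assoc, ← map_mul, mul_assoc, ← mul_assoc (star (word S p.1)),
        hS.star_word_mul_append, word_append S p.1 t]
      simp only [mul_assoc]
    rw [mul_assoc, h3, hS.star_word_mul_self] at h0
    exact one_ne_zero h0
  · obtain ⟨h2, h3⟩ := eq_of_map_wordPair_mul_word hS h1
    rw [if_pos ⟨h2, prefix_of_word_mul_star_mul_eq hS hr (hγ p hp) h3 hγr⟩, mul_assoc, h1,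
      hS.star_word_mul_self, Algebra.algebraMap_eq_smul_one]

lemma symm_cylinder_mem_wordSums [Nontrivial A] {hS : IsCuntzPair S} {a : A ≃⋆ₐ[ℂ] A}
    (ha : a ∈ lambdaInv S hS) (μ : List (Fin 2)) :
    a.symm (word S μ * star (word S μ)) ∈ wordSums S := by
  classical
  have hproj : ∀ ν, star (word S ν * star (word S ν)) = word S ν * star (word S ν) ∧
      word S ν * star (word S ν) * (word S ν * star (word S ν)) = word S ν * star (word S ν) :=
    fun ν => ⟨by simp, by rw [mul_assoc, hS.star_word_mul_self_assoc]⟩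
  obtain ⟨c, hc⟩ := hS.exists_finsupp_norm_sub_lt (a.symm (word S μ * star (word S μ)))
    (ε := 1 / 2) (by norm_num)
  set y := ∑ p ∈ c.support, c p • (word S p.1 * star (word S p.2)) with hy
  have hc' : ‖word S μ * star (word S μ) - a y‖ < 1 / 2 := by
    rw [← norm_map_eq a, map_sub, StarAlgEquiv.apply_symm_apply] at hc
    exact hc
  -- This depth makes `γ` at least as long as every `p.1` occurring in `y`.
  refine hS.mem_of_forall_mul_mem _ (c.support.sup fun p => p.1.length) fun γ hγ => ?_
  have hlen : ∀ p ∈ c.support, p.1.length ≤ γ.length := fun p hp => by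
    rw [hγ]
    exact Finset.le_sup (f := fun p : List (Fin 2) × List (Fin 2) => p.1.length) hp
  set e := a (word S γ * star (word S γ)) with he
  set q := word S μ * star (word S μ) with hq
  have htq : Tame S q := (tame_word μ).mul (hS.tame_star_word μ)
  obtain ⟨n, hn⟩ := (tame_map_wordPair ha (γ, γ)).exists_mul_word_eq_zero_or_self hS
    (by rw [← map_star, (hproj γ).1]) (by rw [← map_mul, (hproj γ).2])
  obtain ⟨m, hm⟩ := htq.exists_mul_word_eq_zero_or_self hS (hproj μ).1 (hproj μ).2
  change ∀ μ : List (Fin 2), n ≤ μ.length → e * word S μ = 0 ∨ e * word S μ = word S μ at hn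
  -- Otherwise the range of `e` contains a cylinder on which `q` is `1` and another on which `q` is
  -- `0`. Compressing `a y` inside either gives the same scalar, which would be within `1/2` of
  -- both.
  have key : q * e = 0 ∨ q * e = e := by
    by_contra! hcon
    have hex : ∀ x : A, q * e ≠ x → ∃ ρ : List (Fin 2), ρ.length = n + m ∧
        q * e * word S ρ ≠ x * word S ρ := by
      intro x hx
      by_contra! hall
      exact hx (hS.eq_of_forall_mul_word (n + m) hall)
    have hcomp : ∀ ρ : List (Fin 2), e * word S ρ = word S ρ → ∃ κ,
        star (word S (ρ ++ κ)) * a y * word S (ρ ++ κ)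
          = algebraMap ℂ A (∑ p ∈ c.support with p.1 = p.2 ∧ p.1 <+: γ, c p) := by
      intro ρ hρ
      obtain ⟨κ, hκ⟩ := hS.exists_forall_decides c.support (tame_map_wordPair ha) ρ
      refine ⟨κ, compression_map_sum hS c hlen hκ ?_⟩
      rw [word_append, ← mul_assoc, hρ]
    obtain ⟨ρ₁, hl₁, h₁⟩ := hex 0 hcon.1
    obtain ⟨ρ₂, hl₂, h₂⟩ := hex e hcon.2
    rw [zero_mul, mul_assoc] at h₁
    rw [mul_assoc] at h₂
    have he₁ : e * word S ρ₁ = word S ρ₁ := (hn ρ₁ (by omega)).resolve_left fun h => by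
      simp [h] at h₁
    have he₂ : e * word S ρ₂ = word S ρ₂ := (hn ρ₂ (by omega)).resolve_left fun h => by
      simp [h] at h₂
    rw [he₁] at h₁
    rw [he₂] at h₂
    have hq₁ := (hm ρ₁ (by omega)).resolve_left h₁
    have hq₂ := (hm ρ₂ (by omega)).resolve_right h₂
    obtain ⟨κ₁, hκ₁⟩ := hcomp ρ₁ he₁
    obtain ⟨κ₂, hκ₂⟩ := hcomp ρ₂ he₂
    have n₁ := norm_compression_sub_lt hS (ρ₁ ++ κ₁) hc'
    have n₂ := norm_compression_sub_lt hS (ρ₂ ++ κ₂) hc'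
    have e₁ : star (word S (ρ₁ ++ κ₁)) * q * word S (ρ₁ ++ κ₁) = 1 := by
      rw [mul_assoc, word_append, ← mul_assoc q, hq₁, ← word_append, hS.star_word_mul_self]
    have e₂ : star (word S (ρ₂ ++ κ₂)) * q * word S (ρ₂ ++ κ₂) = 0 := by
      rw [mul_assoc, word_append, ← mul_assoc q, hq₂, zero_mul, mul_zero]
    rw [hκ₁, e₁] at n₁
    rw [hκ₂, e₂, zero_sub, norm_neg] at n₂
    have := norm_le_norm_add_norm_sub' (1 : A)
      (algebraMap ℂ A (∑ p ∈ c.support with p.1 = p.2 ∧ p.1 <+: γ, c p))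
    rw [CStarRing.norm_one] at this
    linarith
  have hsym : a.symm q * (word S γ * star (word S γ)) = a.symm (q * e) := by
    rw [map_mul a.symm q e, he, StarAlgEquiv.symm_apply_apply]
  rw [hsym]
  rcases key with h | h
  · simp [h]
  · rw [h, he, StarAlgEquiv.symm_apply_apply]
    exact wordPair_mem S γ γ

/-- On each deep cylinder `μ` some term of the approximant must satisfy `a(S_α S_β*) S_μ = S_j S_μ`.
Applying `a⁻¹` expresses `a⁻¹(S_j P_μ)` through `S_α S_β*` and `a⁻¹(P_μ)`, already known to be a
finite sum. -/
lemma symm_generator_mem_wordSums [Nontrivial A] {hS : IsCuntzPair S} {a : A ≃⋆ₐ[ℂ] A}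
    (ha : a ∈ lambdaInv S hS) (j : Fin 2) : a.symm (S j) ∈ wordSums S := by
  obtain ⟨c, hc⟩ := hS.exists_finsupp_norm_sub_lt (a.symm (S j)) one_pos
  set y := ∑ p ∈ c.support, c p • (word S p.1 * star (word S p.2)) with hy
  have hc' : ‖S j - a y‖ < 1 := by
    rw [← norm_map_eq a, map_sub, StarAlgEquiv.apply_symm_apply] at hc
    exact hc
  have hj : word S [j] = S j := by simp [word_cons, word_nil]
  obtain ⟨n, hn⟩ := Tame.exists_common c.support (tame_map_wordPair ha)
  suffices H : S j ∈ (wordSums S).comap (a.symm : A →+ A) from H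
  refine hS.mem_of_forall_mul_mem _ n fun μ hμ => ?_
  rw [AddSubmonoid.mem_comap]
  change a.symm (S j * (word S μ * star (word S μ))) ∈ wordSums S
  have key : ∃ p ∈ c.support, a (word S p.1 * star (word S p.2)) * word S μ = S j * word S μ := by
    obtain ⟨κ, hκ⟩ := hS.exists_forall_decides c.support
      (f := fun p => star (S j) * a (word S p.1 * star (word S p.2)))
      (fun p => Tame.mul (by rw [← hj]; exact hS.tame_star_word [j]) (tame_map_wordPair ha p)) μ
    -- If no term of `S_j* a(y)` fixed the decided cylinder, its compression there would be `0`,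
    -- although it lies within distance less than `1` of the compression of `S_j* S_j = 1`.
    have hex : ∃ p ∈ c.support,
        star (S j) * a (word S p.1 * star (word S p.2)) * word S (μ ++ κ) = word S (μ ++ κ) := by
      by_contra! hall
      have h0 : star (word S (μ ++ κ)) * (star (S j) * a y) * word S (μ ++ κ) = 0 := by
        rw [hy, map_sum, Finset.mul_sum, Finset.mul_sum, Finset.sum_mul]
        refine Finset.sum_eq_zero fun p hp => ?_
        rw [map_smul, mul_smul_comm, mul_smul_comm, smul_mul_assoc,
          (hκ p hp).resolve_right (hall p hp), smul_zero]
      have h1 : ‖star (S j) * S j - star (S j) * a y‖ < 1 := by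
        rw [← mul_sub]
        refine lt_of_le_of_lt (norm_mul_le _ _) ?_
        rw [norm_star, norm_of_isometry (hS.isometry j), one_mul]
        exact hc'
      have h2 := norm_compression_sub_lt hS (μ ++ κ) h1
      rw [h0, hS.isometry, mul_one, hS.star_word_mul_self, sub_zero, CStarRing.norm_one] at h2
      exact lt_irrefl _ h2
    obtain ⟨p, hp, h⟩ := hex
    refine ⟨p, hp, ?_⟩
    rcases hn p hp μ hμ.ge with h0 | ⟨ν, hν⟩
    · rw [mul_assoc, word_append, ← mul_assoc (a _), h0, zero_mul, mul_zero,
        ← word_append] at h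
      exact absurd h.symm (hS.word_ne_zero _)
    · rw [mul_assoc, word_append, ← mul_assoc (a _), hν, ← word_append, ← word_append] at h
      have h1 : star (word S (j :: (μ ++ κ))) * word S (ν ++ κ) = 1 := by
        rw [word_cons, star_mul, mul_assoc, h, hS.star_word_mul_self]
      have h2 := hS.word_injective (eq_of_isometry (hS.star_word_mul_self _)
        (hS.star_word_mul_self _) h1)
      have h3 : ν = j :: μ := List.append_cancel_right (by simpa using h2)
      rw [hν, h3, word_cons]
  obtain ⟨p, -, h⟩ := key
  have h4 : S j * (word S μ * star (word S μ))
      = a (word S p.1 * star (word S p.2)) * (word S μ * star (word S μ)) := by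
    rw [← mul_assoc, ← h, mul_assoc]
  rw [h4, map_mul, StarAlgEquiv.symm_apply_apply]
  exact hS.mul_mem_wordSums (wordPair_mem S _ _) (symm_cylinder_mem_wordSums ha μ)

lemma symm_mem_wordSums [Nontrivial A] {hS : IsCuntzPair S} {a : A ≃⋆ₐ[ℂ] A}
    (ha : a ∈ lambdaInv S hS) {x : A} (hx : x ∈ wordSums S) : a.symm x ∈ wordSums S := by
  have hword : ∀ μ, a.symm (word S μ) ∈ wordSums S := by
    intro μ
    induction μ with
    | nil => simpa [word_nil] using one_mem_wordSums S
    | cons i μ ih =>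
      rw [word_cons, map_mul]
      exact hS.mul_mem_wordSums (symm_generator_mem_wordSums ha i) ih
  induction hx using AddSubmonoid.closure_induction with
  | zero => simp
  | add x y _ _ hx hy => rw [map_add]; exact add_mem hx hy
  | mem x hx =>
    obtain ⟨p, rfl⟩ := hx
    dsimp only
    rw [map_mul, map_star]
    exact hS.mul_mem_wordSums (hword _) (star_mem_wordSums S (hword _))

/-- Every element of `λ(𝒮₂)⁻¹` restricts to an automorphism of `𝒮₂`. -/
theorem exists_mem_lambdaRestrict [Nontrivial A] (hS : IsCuntzPair S) {a : A ≃⋆ₐ[ℂ] A}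
    (ha : a ∈ lambdaInv S hS) : ∃ t ∈ lambdaRestrict S hS, ∀ v : thompson S hS,
      ((t v : unitary A) : A) = a ((v : unitary A) : A) := by
  have hunit : ∀ (b : A ≃⋆ₐ[ℂ] A) (v : unitary A), b (v : A) ∈ unitary A := fun b v =>
    Unitary.mem_iff.2 ⟨by rw [← map_star, ← map_mul, Unitary.star_mul_self_of_mem v.2, map_one],
      by rw [← map_star, ← map_mul, Unitary.mul_star_self_of_mem v.2, map_one]⟩
  let t : MulAut (thompson S hS) :=
    { toFun := fun v => ⟨⟨a ((v : unitary A) : A), hunit a v⟩, mem_wordSums_map ha v.2⟩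
      invFun := fun v => ⟨⟨a.symm ((v : unitary A) : A), hunit a.symm v⟩,
        symm_mem_wordSums ha v.2⟩
      left_inv := fun v => Subtype.ext (Subtype.ext (StarAlgEquiv.symm_apply_apply a _))
      right_inv := fun v => Subtype.ext (Subtype.ext (StarAlgEquiv.apply_symm_apply a _))
      map_mul' := fun v w => Subtype.ext (Subtype.ext (map_mul a _ _)) }
  exact ⟨t, ⟨a, ha, fun v => rfl⟩, fun v => rfl⟩

/-! ### Inner automorphisms -/

/-- Inner automorphisms of `𝒮₂` are restrictions of elements of `λ(𝒮₂)⁻¹`. -/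
theorem range_conj_le_lambdaRestrict (hS : IsCuntzPair S) :
    (MulAut.conj : thompson S hS →* MulAut (thompson S hS)).range ≤ lambdaRestrict S hS := by
  rintro _ ⟨v, rfl⟩
  set u : A := ((v : unitary A) : A) with hu
  have hu1 : star u * u = 1 := Unitary.coe_star_mul_self _
  have hu2 : u * star u = 1 := Unitary.coe_mul_star_self _
  have hsum : S 0 * star (S 0) + S 1 * star (S 1) = 1 := by
    simpa [Fin.sum_univ_two] using hS.sum_range
  have hgen : ∀ i, S i ∈ wordSums S := fun i => by
    simpa [word_cons, word_nil] using IsCuntzPair.word_mem_wordSums S [i]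
  -- This is `u φ(u*)` for the canonical endomorphism `φ(x) = ∑ S_i x S_i*`, chosen so that `w S_i =
  -- u S_i u*`.
  set w : A := ∑ i, u * S i * star u * star (S i) with hw
  have hwS : ∀ i, w * S i = u * S i * star u := by
    intro i
    rw [hw, Finset.sum_mul, Finset.sum_eq_single i]
    · rw [mul_assoc, hS.isometry, mul_one]
    · intro j _ hj
      rw [mul_assoc, hS.orthogonal hj, mul_zero]
    · simp
  have hw1 : star w * w = 1 := by
    have h : star w * w = ∑ i, star w * (w * S i) * star (S i) := by
      simp only [← mul_assoc]
      simp only [mul_assoc _ (S _) (star (S _)), ← Finset.mul_sum, hS.sum_range, mul_one]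
    rw [h, ← hS.sum_range]
    refine Finset.sum_congr rfl fun i _ => ?_
    rw [hwS, hw, star_sum, Finset.sum_mul, Finset.sum_eq_single i]
    · simp only [star_mul, star_star]
      calc _ = S i * (u * ((star (S i) * ((star u * u) * S i)) * star u)) * star (S i) := by
            simp only [mul_assoc]
        _ = _ := by rw [hu1, one_mul, hS.isometry, one_mul, hu2, mul_one]
    · intro j _ hj
      simp only [star_mul, star_star]
      calc _ = S j * (u * ((star (S j) * ((star u * u) * S i)) * star u)) := by
            simp only [mul_assoc]
        _ = 0 := by rw [hu1, one_mul, hS.orthogonal hj, zero_mul, mul_zero, mul_zero]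
    · simp
  have hw2 : w * star w = 1 := by
    have h : ∀ i, w * S i * star (S i) * star w = u * S i * star (S i) * star u := by
      intro i
      have : star (S i) * star w = u * star (S i) * star u := by
        rw [← star_mul, hwS]; simp [mul_assoc]
      rw [mul_assoc _ _ (star w), this, hwS]
      calc _ = u * S i * (star u * u) * star (S i) * star u := by simp only [mul_assoc]
        _ = _ := by rw [hu1, mul_one]
    calc w * star w = w * (S 0 * star (S 0) + S 1 * star (S 1)) * star w := by
          rw [hsum, mul_one]
      _ = u * (S 0 * star (S 0) + S 1 * star (S 1)) * star u := by
          simp only [mul_add, add_mul, ← mul_assoc, h]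
      _ = 1 := by rw [hsum, mul_one, hu2]
  have hum : u ∈ wordSums S := v.2
  have hus : star u ∈ wordSums S := star_mem_wordSums S hum
  have hwm : w ∈ wordSums S := sum_mem fun i _ => hS.mul_mem_wordSums (hS.mul_mem_wordSums
    (hS.mul_mem_wordSums hum (hgen i)) hus) (star_mem_wordSums S (hgen i))
  refine ⟨Unitary.conjStarAlgAut ℂ A (v : unitary A),
    ⟨⟨w, Unitary.mem_iff.2 ⟨hw1, hw2⟩⟩, hwm, fun i => ?_⟩, fun x => ?_⟩
  · rw [Unitary.conjStarAlgAut_apply, hwS]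
  · rw [Unitary.conjStarAlgAut_apply]
    rfl

end
end Cuntz
-- Complete prefix codes
namespace Cuntz

/-- A finite set of words is a complete prefix code: its members are pairwise incomparable, and
every sufficiently long word begins with one of them. -/
structure IsCode (s : Finset (List (Fin 2))) : Prop where
  perp : ∀ a ∈ s, ∀ b ∈ s, a ≠ b → Perp a b
  cover : ∃ n, ∀ c : List (Fin 2), n ≤ c.length → ∃ a ∈ s, a <+: c

lemma exists_isCode_of_le_length (n : ℕ) :
    ∃ s : Finset (List (Fin 2)), IsCode s ∧ ∀ a ∈ s, n ≤ a.length := by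
  classical
  have hmem : ∀ a : List (Fin 2),
      a ∈ (Finset.univ : Finset (Fin n → Fin 2)).image List.ofFn ↔ a.length = n := by
    intro a
    simp only [Finset.mem_image, Finset.mem_univ, true_and]
    refine ⟨?_, ?_⟩
    · rintro ⟨f, rfl⟩; simp
    · rintro rfl; exact ⟨a.get, List.ofFn_get a⟩
  refine ⟨_, ⟨fun a ha b hb hab => ?_, n, fun c hc => ⟨c.take n, ?_, List.take_prefix n c⟩⟩,
    fun a ha => ((hmem a).1 ha).ge⟩
  · rw [hmem] at ha hb
    exact ⟨fun h => hab (h.eq_of_length (ha.trans hb.symm)),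
      fun h => hab (h.eq_of_length (hb.trans ha.symm)).symm⟩
  · rw [hmem]; simp [hc]

lemma IsCode.eq_of_prefix {s : Finset (List (Fin 2))} (hs : IsCode s) {a b : List (Fin 2)}
    (ha : a ∈ s) (hb : b ∈ s) (h : a <+: b) : a = b := by
  by_contra hab
  exact (hs.perp a ha b hb hab).1 h

/-- The sibling of a longest member must be covered by a member no longer than itself; a proper
prefix of it would also be a prefix of the longest member. -/
lemma IsCode.exists_siblings {s : Finset (List (Fin 2))} (hs : IsCode s) (hnil : [] ∉ s) :
    ∃ c : List (Fin 2), c ++ [0] ∈ s ∧ c ++ [1] ∈ s := by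
  obtain ⟨n, hn⟩ := hs.cover
  have hne : s.Nonempty := by
    obtain ⟨a, ha, -⟩ := hn (List.replicate n 0) (by simp)
    exact ⟨a, ha⟩
  obtain ⟨a, ha, hmax⟩ := s.exists_max_image List.length hne
  obtain ⟨c, i, rfl⟩ : ∃ c i, a = c ++ [i] := by
    rcases List.eq_nil_or_concat a with rfl | ⟨c, i, rfl⟩
    · exact absurd ha hnil
    · exact ⟨c, i, by simp⟩
  have hsib : c ++ [i + 1] ∈ s := by
    obtain ⟨b, hb, hbp⟩ := hn (c ++ [i + 1] ++ List.replicate n 0)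
      (by simp; omega)
    have hlen : b.length ≤ (c ++ [i + 1]).length := by simpa using hmax b hb
    have hb2 : b <+: c ++ [i + 1] :=
      List.prefix_of_prefix_length_le hbp (List.prefix_append _ _) hlen
    rcases List.prefix_concat_iff.1 (by simpa using hb2) with h | h
    · rwa [← h]
    · have h1 := hs.eq_of_prefix hb ha (h.trans (List.prefix_append c [i]))
      rw [h1] at h
      exact absurd h.length_le (by simp)
  have hall : ∀ j, c ++ [j] ∈ s := fun j => by
    rcases fin_two_eq_or i j with rfl | rfl
    exacts [ha, hsib]
  exact ⟨c, hall 0, hall 1⟩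

lemma IsCode.merge {s : Finset (List (Fin 2))} (hs : IsCode s) {c : List (Fin 2)}
    (h0 : c ++ [0] ∈ s) (h1 : c ++ [1] ∈ s) :
    IsCode (insert c ((s.erase (c ++ [0])).erase (c ++ [1]))) := by
  have hc : ∀ b ∈ (s.erase (c ++ [0])).erase (c ++ [1]), Perp c b := by
    intro b hb
    simp only [Finset.mem_erase] at hb
    obtain ⟨hb1, hb0, hb⟩ := hb
    constructor
    · rintro ⟨t, rfl⟩
      cases t with
      | nil =>
        have := hs.eq_of_prefix hb h0 (by simp)
        simp at this
      | cons i t =>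
        have key : ∀ i, c ++ [i] ∈ s → c ++ i :: t ∈ s → c ++ i :: t = c ++ [i] := fun i hi ht =>
          (hs.eq_of_prefix hi ht ⟨t, by simp⟩).symm
        rcases fin_two_eq_or 0 i with rfl | rfl
        · exact hb0 (key 0 h0 hb)
        · exact hb1 (key 1 h1 hb)
    · intro h
      have := hs.eq_of_prefix hb h0 (h.trans (List.prefix_append _ _))
      exact hb0 this
  constructor
  · intro a ha b hb hab
    rcases Finset.mem_insert.1 ha with rfl | ha
    · rcases Finset.mem_insert.1 hb with rfl | hb
      · exact absurd rfl hab
      · exact hc b hb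
    · rcases Finset.mem_insert.1 hb with rfl | hb
      · exact (hc a ha).symm
      · exact hs.perp a (Finset.mem_of_mem_erase (Finset.mem_of_mem_erase ha)) b
          (Finset.mem_of_mem_erase (Finset.mem_of_mem_erase hb)) hab
  · obtain ⟨n, hn⟩ := hs.cover
    refine ⟨n, fun d hd => ?_⟩
    obtain ⟨a, ha, had⟩ := hn d hd
    by_cases ha0 : a = c ++ [0]
    · exact ⟨c, Finset.mem_insert_self _ _, (List.prefix_append _ _).trans (ha0 ▸ had)⟩
    by_cases ha1 : a = c ++ [1]
    · exact ⟨c, Finset.mem_insert_self _ _, (List.prefix_append _ _).trans (ha1 ▸ had)⟩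
    exact ⟨a, by simp [ha0, ha1, ha], had⟩

lemma card_merge_lt {s : Finset (List (Fin 2))} {c : List (Fin 2)}
    (h0 : c ++ [0] ∈ s) (h1 : c ++ [1] ∈ s) :
    (insert c ((s.erase (c ++ [0])).erase (c ++ [1]))).card < s.card := by
  have h2 : c ++ [1] ∈ s.erase (c ++ [0]) := by simp [h1]
  have := Finset.card_erase_add_one h0
  have := Finset.card_erase_add_one h2
  have := Finset.card_insert_le c ((s.erase (c ++ [0])).erase (c ++ [1]))
  omega

/-! ### Swaps of cylinders -/

section
variable {A : Type u} [CStarAlgebra A] {S : Fin 2 → A}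

/-- The self-adjoint element exchanging the cylinders of two incomparable words `a` and `b`. -/
def swapElement (S : Fin 2 → A) (a b : List (Fin 2)) : A :=
  1 - (word S a - word S b) * star (word S a - word S b)

lemma swapElement_comm (a b : List (Fin 2)) : swapElement S a b = swapElement S b a := by
  rw [swapElement, swapElement, ← neg_sub (word S b) (word S a), star_neg, neg_mul_neg]

lemma star_swapElement (a b : List (Fin 2)) : star (swapElement S a b) = swapElement S a b := by
  simp [swapElement]

namespace IsCuntzPair

lemma star_sub_word_mul_self (hS : IsCuntzPair S) {a b : List (Fin 2)} (h : Perp a b) :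
    star (word S a - word S b) * (word S a - word S b) = 2 := by
  rw [star_sub, sub_mul, mul_sub, mul_sub, hS.star_word_mul_self, hS.star_word_mul_self,
    hS.star_word_mul_of_perp h, hS.star_word_mul_of_perp h.symm, sub_zero, zero_sub,
    sub_neg_eq_add, one_add_one_eq_two]

lemma swapElement_mul_self (hS : IsCuntzPair S) {a b : List (Fin 2)} (h : Perp a b) :
    swapElement S a b * swapElement S a b = 1 := by
  have h2 := hS.star_sub_word_mul_self h
  unfold swapElement
  generalize word S a - word S b = d at h2
  have h3 : d * star d * (d * star d) = d * star d + d * star d := by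
    rw [mul_assoc, ← mul_assoc (star d), h2, two_mul, mul_add]
  rw [sub_mul, mul_sub, mul_sub, h3]
  simp

lemma swapElement_mul_left (hS : IsCuntzPair S) {a b : List (Fin 2)} (h : Perp a b) :
    swapElement S a b * word S a = word S b := by
  have h1 : star (word S a - word S b) * word S a = 1 := by
    rw [star_sub, sub_mul, hS.star_word_mul_self, hS.star_word_mul_of_perp h.symm, sub_zero]
  rw [swapElement, sub_mul, one_mul, mul_assoc, h1, mul_one, sub_sub_cancel]

lemma swapElement_mul_right (hS : IsCuntzPair S) {a b : List (Fin 2)} (h : Perp a b) :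
    swapElement S a b * word S b = word S a := by
  rw [swapElement_comm, hS.swapElement_mul_left h.symm]

lemma swapElement_mul_of_perp (hS : IsCuntzPair S) {a b c : List (Fin 2)} (ha : Perp a c)
    (hb : Perp b c) : swapElement S a b * word S c = word S c := by
  have h1 : star (word S a - word S b) * word S c = 0 := by
    rw [star_sub, sub_mul, hS.star_word_mul_of_perp ha, hS.star_word_mul_of_perp hb, sub_zero]
  rw [swapElement, sub_mul, one_mul, mul_assoc, h1, mul_zero, sub_zero]

lemma tame_swapElement (hS : IsCuntzPair S) {a b : List (Fin 2)} (h : Perp a b) :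
    Tame S (swapElement S a b) := by
  refine ⟨a.length + b.length, fun c hc => Or.inr ?_⟩
  have key : ∀ d : List (Fin 2), d.length ≤ c.length → d <+: c ∨ Perp d c := fun d hd => by
    rcases prefix_or_prefix_or_perp d c with h | h | h
    · exact Or.inl h
    · exact Or.inl (h.eq_of_length (le_antisymm h.length_le hd) ▸ List.prefix_rfl)
    · exact Or.inr h
  rcases key a (by omega) with ⟨t, rfl⟩ | ha
  · exact ⟨b ++ t, by rw [word_append, ← mul_assoc, hS.swapElement_mul_left h, word_append]⟩
  rcases key b (by omega) with ⟨t, rfl⟩ | hb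
  · exact ⟨a ++ t, by rw [word_append, ← mul_assoc, hS.swapElement_mul_right h, word_append]⟩
  exact ⟨c, hS.swapElement_mul_of_perp ha hb⟩

end IsCuntzPair

open Classical in
/-- The element of `𝒮₂` exchanging the cylinders of two incomparable words (and `1` if the words
are comparable). -/
noncomputable def swap (hS : IsCuntzPair S) (a b : List (Fin 2)) : thompson S hS :=
  if h : Perp a b then
    ⟨⟨swapElement S a b, Unitary.mem_iff.2
      ⟨by rw [star_swapElement, hS.swapElement_mul_self h],
        by rw [star_swapElement, hS.swapElement_mul_self h]⟩⟩,
      hS.mem_wordSums_of_tame (hS.tame_swapElement h)⟩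
  else 1

lemma coe_swap (hS : IsCuntzPair S) {a b : List (Fin 2)} (h : Perp a b) :
    ((swap hS a b : unitary A) : A) = swapElement S a b := by
  rw [swap, dif_pos h]

lemma thompson_ext {hS : IsCuntzPair S} {v w : thompson S hS}
    (h : ((v : unitary A) : A) = ((w : unitary A) : A)) : v = w :=
  Subtype.ext (Subtype.ext h)

lemma swap_comm (hS : IsCuntzPair S) {a b : List (Fin 2)} (h : Perp a b) :
    swap hS a b = swap hS b a :=
  thompson_ext (by rw [coe_swap hS h, coe_swap hS h.symm, swapElement_comm])

lemma swap_inv (hS : IsCuntzPair S) {a b : List (Fin 2)} (h : Perp a b) :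
    (swap hS a b)⁻¹ = swap hS a b := by
  rw [inv_eq_iff_mul_eq_one]
  exact thompson_ext (by
    rw [Subgroup.coe_mul, Submonoid.coe_mul, coe_swap hS h, hS.swapElement_mul_self h]; rfl)

/-- With `d = S_a - S_b`, conjugating `1 - d d*` by `v` gives `1 - (v d)(v d)*`. -/
lemma conj_swap {hS : IsCuntzPair S} (v : thompson S hS) {a b a' b' : List (Fin 2)}
    (h : Perp a b) (h' : Perp a' b') (ha : ((v : unitary A) : A) * word S a = word S a')
    (hb : ((v : unitary A) : A) * word S b = word S b') :
    v * swap hS a b * v⁻¹ = swap hS a' b' := by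
  rw [mul_inv_eq_iff_eq_mul]
  apply thompson_ext
  rw [Subgroup.coe_mul, Submonoid.coe_mul, Subgroup.coe_mul, Submonoid.coe_mul, coe_swap hS h,
    coe_swap hS h', swapElement, swapElement, ← ha, ← hb, ← mul_sub, star_mul]
  have hv : star ((v : unitary A) : A) * ((v : unitary A) : A) = 1 := Unitary.coe_star_mul_self _
  generalize word S a - word S b = d
  rw [mul_sub _ 1, sub_mul 1, mul_one, one_mul]
  simp only [mul_assoc, hv, mul_one]

lemma swap_commute (hS : IsCuntzPair S) {a b c d : List (Fin 2)} (hab : Perp a b)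
    (hcd : Perp c d) (hac : Perp a c) (had : Perp a d) (hbc : Perp b c) (hbd : Perp b d) :
    Commute (swap hS a b) (swap hS c d) := by
  have h := conj_swap (swap hS a b) hcd hcd
    (by rw [coe_swap hS hab, hS.swapElement_mul_of_perp hac hbc])
    (by rw [coe_swap hS hab, hS.swapElement_mul_of_perp had hbd])
  exact mul_inv_eq_iff_eq_mul.1 h

lemma perp_append_singleton {i j : Fin 2} (hij : i ≠ j) (a : List (Fin 2)) :
    Perp (a ++ [i]) (a ++ [j]) :=
  perp_append_append_self a (perp_cons_of_ne hij [] [])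

/-- Here `d d*` splits as the sum of `d P_i d*`, and the two pieces are orthogonal because `d* d =
2` is a scalar. -/
lemma swap_split (hS : IsCuntzPair S) {a b : List (Fin 2)} (h : Perp a b) :
    swap hS (a ++ [0]) (b ++ [0]) * swap hS (a ++ [1]) (b ++ [1]) = swap hS a b := by
  apply thompson_ext
  rw [Subgroup.coe_mul, Submonoid.coe_mul, coe_swap hS h, coe_swap hS (h.append _ _),
    coe_swap hS (h.append _ _)]
  have hsum : S 0 * star (S 0) + S 1 * star (S 1) = 1 := by
    simpa [Fin.sum_univ_two] using hS.sum_range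
  have h2 := hS.star_sub_word_mul_self h
  simp only [swapElement, word_append, word_cons, word_nil, mul_one, ← sub_mul]
  generalize word S a - word S b = d at h2
  have hz : d * S 0 * star (d * S 0) * (d * S 1 * star (d * S 1)) = 0 := by
    calc _ = d * S 0 * (star (S 0) * (star d * d) * S 1) * star (d * S 1) := by
          simp only [star_mul, mul_assoc]
      _ = 0 := by
        rw [h2, mul_two, add_mul, hS.orthogonal (by decide), add_zero, mul_zero, zero_mul]
  have hd : d * star d = d * S 0 * star (d * S 0) + d * S 1 * star (d * S 1) := by
    calc d * star d = d * (S 0 * star (S 0) + S 1 * star (S 1)) * star d := by rw [hsum, mul_one]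
      _ = _ := by simp only [star_mul, mul_add, add_mul, mul_assoc]
  rw [hd, sub_mul, mul_sub, mul_sub, hz]
  simp only [one_mul, mul_one, sub_zero]
  abel

/-- A swap is the commutator of two products of swaps supported on the same cylinders. -/
lemma swap_eq_commutator (hS : IsCuntzPair S) {a b : List (Fin 2)} (h : Perp a b) :
    swap hS (a ++ [0]) (b ++ [0]) *
      (swap hS (a ++ [0]) (a ++ [1]) * swap hS (b ++ [0]) (b ++ [1])) *
      (swap hS (a ++ [0]) (b ++ [0]))⁻¹ *
      (swap hS (a ++ [0]) (a ++ [1]) * swap hS (b ++ [0]) (b ++ [1]))⁻¹ = swap hS a b := by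
  have h01 : ∀ a : List (Fin 2), Perp (a ++ [0]) (a ++ [1]) :=
    perp_append_singleton (by decide)
  have hc := conj_swap (swap hS (a ++ [0]) (a ++ [1]) * swap hS (b ++ [0]) (b ++ [1]))
    (h.append [0] [0]) (h.append [1] [1])
    (by
      rw [Subgroup.coe_mul, Submonoid.coe_mul, coe_swap hS (h01 a), coe_swap hS (h01 b), mul_assoc,
        hS.swapElement_mul_of_perp (h.symm.append _ _) (h.symm.append _ _),
        hS.swapElement_mul_left (h01 a)])
    (by
      rw [Subgroup.coe_mul, Submonoid.coe_mul, coe_swap hS (h01 a), coe_swap hS (h01 b), mul_assoc,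
        hS.swapElement_mul_left (h01 b),
        hS.swapElement_mul_of_perp (h.append _ _) (h.append _ _)])
  rw [swap_inv hS (h.append _ _), mul_assoc, mul_assoc, ← mul_assoc _ (swap hS _ _) _⁻¹, hc,
    swap_split hS h]

lemma swap_mem_of_perp {hS : IsCuntzPair S} (N : Subgroup (thompson S hS)) [N.Normal]
    {a b c : List (Fin 2)} (hab : Perp a b) (hac : Perp a c) (hbc : Perp b c)
    (h : swap hS a b ∈ N) : swap hS c b ∈ N := by
  have h1 := ‹N.Normal›.conj_mem _ h (swap hS a c)
  rwa [conj_swap (swap hS a c) hab hbc.symm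
    (by rw [coe_swap hS hac, hS.swapElement_mul_left hac])
    (by rw [coe_swap hS hac, hS.swapElement_mul_of_perp hab hbc.symm])] at h1

lemma swap_mem_of_perp' {hS : IsCuntzPair S} (N : Subgroup (thompson S hS)) [N.Normal]
    {a b c : List (Fin 2)} (hab : Perp a b) (hac : Perp a c) (hbc : Perp b c)
    (h : swap hS a b ∈ N) : swap hS a c ∈ N := by
  rw [swap_comm hS hac]
  exact swap_mem_of_perp N hab.symm hbc hac (by rwa [swap_comm hS hab.symm])

lemma exists_mem_exchange {hS : IsCuntzPair S} (K : Subgroup (thompson S hS))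
    (hK : ∀ a b, Perp a b → swap hS a b ∈ K) {s : Finset (List (Fin 2))} (hs : IsCode s)
    {c e : List (Fin 2)} (hc : c ∈ s) (he : e ∈ s) :
    ∃ k ∈ K, ((k : unitary A) : A) * word S c = word S e ∧
      ((k : unitary A) : A) * word S e = word S c ∧
      ∀ b ∈ s, b ≠ c → b ≠ e → ((k : unitary A) : A) * word S b = word S b := by
  by_cases hce : c = e
  · subst hce
    exact ⟨1, one_mem K, one_mul _, one_mul _, fun b _ _ _ => one_mul _⟩
  · have hp := hs.perp c hc e he hce
    refine ⟨swap hS c e, hK c e hp, ?_, ?_, fun b hb hbc hbe => ?_⟩ <;> rw [coe_swap hS hp]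
    · exact hS.swapElement_mul_left hp
    · exact hS.swapElement_mul_right hp
    · exact hS.swapElement_mul_of_perp (hs.perp c hc b hb hbc.symm) (hs.perp e he b hb hbe.symm)

/-! ### Normal subgroups contain all swaps -/

variable [Nontrivial A]

/-- Double commutator trick. With `x`, `y` supported on the cylinders of `a` and `b`, `[g, x] = k
x⁻¹` lies in `N`, where `k = g x g⁻¹` lives on the disjoint cylinders `a'` and `b'`. Thus `k`
commutes with `x` and `y`, and taking the commutator with `y` removes it, leaving a commutator equal
to the swap. -/
lemma swap_mem_of_disjoint_image {hS : IsCuntzPair S} (N : Subgroup (thompson S hS)) [N.Normal]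
    {g : thompson S hS} (hg : g ∈ N) {a b a' b' : List (Fin 2)} (h : Perp a b)
    (ha : ((g : unitary A) : A) * word S a = word S a')
    (hb : ((g : unitary A) : A) * word S b = word S b')
    (haa : Perp a a') (hab : Perp a b') (hba : Perp b a') (hbb : Perp b b') :
    swap hS a b ∈ N := by
  have h01 : ∀ a : List (Fin 2), Perp (a ++ [0]) (a ++ [1]) :=
    perp_append_singleton (by decide)
  have h' : Perp a' b' := by
    apply hS.perp_of_star_word_mul
    rw [← ha, ← hb, star_mul, mul_assoc, ← mul_assoc (star ((g : unitary A) : A)),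
      Unitary.coe_star_mul_self, one_mul, hS.star_word_mul_of_perp h]
  set x := swap hS (a ++ [0]) (b ++ [0]) with hx
  set y := swap hS (a ++ [0]) (a ++ [1]) * swap hS (b ++ [0]) (b ++ [1]) with hy
  set k := swap hS (a' ++ [0]) (b' ++ [0]) with hk
  have hkg : g * x * g⁻¹ = k := conj_swap g (h.append _ _) (h'.append _ _)
    (by rw [word_append, ← mul_assoc, ha, word_append])
    (by rw [word_append, ← mul_assoc, hb, word_append])
  have hkx : Commute k x := swap_commute hS (h'.append _ _) (h.append _ _)
    (haa.symm.append _ _) (hba.symm.append _ _) (hab.symm.append _ _) (hbb.symm.append _ _)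
  have hky : Commute k y := Commute.mul_right
    (swap_commute hS (h'.append _ _) (h01 a)
      (haa.symm.append _ _) (haa.symm.append _ _) (hab.symm.append _ _) (hab.symm.append _ _))
    (swap_commute hS (h'.append _ _) (h01 b)
      (hba.symm.append _ _) (hba.symm.append _ _) (hbb.symm.append _ _) (hbb.symm.append _ _))
  have hmem : k * x⁻¹ ∈ N := by
    have h1 : x * g⁻¹ * x⁻¹ ∈ N := ‹N.Normal›.conj_mem _ (inv_mem hg) x
    have h2 := mul_mem hg h1
    rwa [← hkg, show g * x * g⁻¹ * x⁻¹ = g * (x * g⁻¹ * x⁻¹) by group]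
  rw [swap_inv hS (h.append _ _)] at hmem
  have h3 : y * (k * x)⁻¹ * y⁻¹ ∈ N := ‹N.Normal›.conj_mem _ (inv_mem hmem) y
  have h4 := mul_mem hmem h3
  have h5 : k * x * (y * (k * x)⁻¹ * y⁻¹) = x * y * x⁻¹ * y⁻¹ := by
    have hkz : Commute k (x * y * x⁻¹) := (hkx.mul_right hky).mul_right hkx.inv_right
    calc k * x * (y * (k * x)⁻¹ * y⁻¹) = k * (x * y * x⁻¹) * k⁻¹ * y⁻¹ := by group
      _ = x * y * x⁻¹ * y⁻¹ := by rw [hkz.eq, mul_inv_cancel_right]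
  rw [h5, hx, hy, swap_eq_commutator hS h] at h4
  exact h4

/-- A nontrivial normal subgroup of `𝒮₂` contains all swaps of the two halves of a cylinder inside
some fixed cylinder. -/
lemma exists_forall_swap_mem {hS : IsCuntzPair S} (N : Subgroup (thompson S hS)) [N.Normal]
    (hN : N ≠ ⊥) :
    ∃ m : List (Fin 2), ∀ r, swap hS (m ++ r ++ [0]) (m ++ r ++ [1]) ∈ N := by
  obtain ⟨g, hg, hg1⟩ := N.ne_bot_iff_exists_ne_one.1 hN |>.elim fun g hg =>
    (⟨g, g.2, fun h => hg (Subtype.ext h)⟩ : ∃ g ∈ N, g ≠ 1)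
  have hm : ∃ m m' : List (Fin 2), Perp m m' ∧
      ((g : unitary A) : A) * word S m = word S m' := by
    obtain ⟨n, hn⟩ := hS.exists_thompson_mul_word g.2
    obtain ⟨a, ha, b, hb, hne⟩ : ∃ a : List (Fin 2), n ≤ a.length ∧
        ∃ b, ((g : unitary A) : A) * word S a = word S b ∧ a ≠ b := by
      by_contra! hcon
      refine hg1 (thompson_ext (hS.eq_of_forall_mul_word n fun a ha => ?_))
      obtain ⟨b, hb⟩ := hn a ha.ge
      rw [hb, ← hcon a ha.ge b hb]
      exact (one_mul _).symm
    rcases prefix_or_prefix_or_perp a b with ⟨t, rfl⟩ | ⟨t, rfl⟩ | hp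
    · cases t with
      | nil => simp at hne
      | cons i t =>
        refine ⟨a ++ [i + 1], a ++ i :: t ++ [i + 1], ?_, ?_⟩
        · rw [List.append_assoc]
          exact perp_append_append_self a (perp_cons_of_ne (fin_two_add_one_ne i) _ _)
        · rw [word_append, ← mul_assoc, hb, ← word_append]
    · cases t with
      | nil => simp at hne
      | cons i t =>
        refine ⟨b ++ i :: t ++ [i + 1], b ++ [i + 1], ?_, ?_⟩
        · rw [List.append_assoc]
          exact perp_append_append_self b (perp_cons_of_ne (fin_two_add_one_ne i).symm _ _)
        · rw [word_append, ← mul_assoc, hb, ← word_append]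
    · exact ⟨a, b, hp, hb⟩
  obtain ⟨m, m', hp, hmm⟩ := hm
  have hmul : ∀ t, ((g : unitary A) : A) * word S (m ++ t) = word S (m' ++ t) := fun t => by
    rw [word_append, ← mul_assoc, hmm, word_append]
  refine ⟨m, fun r => swap_mem_of_disjoint_image N hg (perp_append_singleton (by decide) _)
    (a' := m' ++ (r ++ [0])) (b' := m' ++ (r ++ [1])) ?_ ?_ ?_ ?_ ?_ ?_⟩
  · rw [List.append_assoc, hmul]
  · rw [List.append_assoc, hmul]
  all_goals
    rw [List.append_assoc]
    exact hp.append _ _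

/-- Conjugation by swaps transports a known swap in `N` to a new pair, provided the cylinders on the
way are disjoint. The work is to secure that room, which fails when `c` and `d` already fill the
whole space. -/
lemma forall_swap_mem {hS : IsCuntzPair S} (N : Subgroup (thompson S hS)) [N.Normal]
    (hN : N ≠ ⊥) {c d : List (Fin 2)} (hcd : Perp c d) : swap hS c d ∈ N := by
  obtain ⟨m₀, hm₀⟩ := exists_forall_swap_mem N hN
  have h01 : ∀ a : List (Fin 2), Perp (a ++ [0]) (a ++ [1]) :=
    perp_append_singleton (by decide)
  have both : ∀ {m c d : List (Fin 2)}, swap hS (m ++ [0]) (m ++ [1]) ∈ N → Perp m c → Perp m d →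
      Perp c d → swap hS c d ∈ N := by
    intro m c d hm hc hd hcd
    refine swap_mem_of_perp' N (hc.symm.append_right _) hcd (hd.append_left _)
      (swap_mem_of_perp N (h01 m) (hc.append_left _) (hc.append_left _) hm)
  -- The known swap sits inside `c`, so it is first carried to the two halves of the spare cylinder
  -- `e`.
  have inside : ∀ {m c d e : List (Fin 2)}, swap hS (m ++ [0]) (m ++ [1]) ∈ N → c <+: m →
      Perp c d → Perp e c → Perp e d → swap hS c d ∈ N := by
    rintro _ c d e hm ⟨t, rfl⟩ hcd hec hed
    have he : swap hS (e ++ [0]) (e ++ [1]) ∈ N :=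
      both hm (hec.symm.append _ _) (hec.symm.append _ _) (h01 e)
    exact both he hec hed hcd
  have third : ∀ {c d e : List (Fin 2)}, Perp c d → Perp e c → Perp e d → swap hS c d ∈ N := by
    intro c d e hcd hec hed
    have key : ∀ m x : List (Fin 2), ∃ t, x <+: m ++ t ∨ Perp (m ++ t) x := by
      intro m x
      rcases prefix_or_prefix_or_perp m x with ⟨t, rfl⟩ | h | h
      · exact ⟨t, Or.inl List.prefix_rfl⟩
      · exact ⟨[], Or.inl (by simpa using h)⟩
      · exact ⟨[], Or.inr (by simpa using h)⟩
    obtain ⟨t, ht⟩ := key m₀ c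
    obtain ⟨s, hs⟩ := key (m₀ ++ t) d
    have hm := hm₀ (t ++ s)
    rw [← List.append_assoc] at hm
    rcases ht with ht | ht
    · exact inside hm (ht.trans (List.prefix_append _ _)) hcd hec hed
    · rcases hs with hs | hs
      · rw [swap_comm hS hcd]
        exact inside hm hs hcd.symm hed hec
      · exact both hm (ht.append_left _) hs hcd
  -- Splitting creates the spare cylinder: `c ++ [1]` for the first factor, `c ++ [0]` for the
  -- second.
  rw [← swap_split hS hcd]
  exact mul_mem (third (e := c ++ [1]) (hcd.append _ _) (h01 c).symm (hcd.append _ _))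
    (third (e := c ++ [0]) (hcd.append _ _) (h01 c) (hcd.append _ _))

/-! ### Generation by swaps -/

lemma IsCuntzPair.eq_nil_of_word_mul_star (hS : IsCuntzPair S) {a : List (Fin 2)}
    (h : word S a * star (word S a) = 1) : a = [] := by
  cases a with
  | nil => rfl
  | cons i a =>
    have h1 := hS.star_word_mul_of_perp_assoc
      (perp_cons_of_ne (fin_two_add_one_ne i) [] a) (star (word S (i :: a)))
    rw [h, mul_one, star_eq_zero] at h1
    exact absurd h1 (hS.word_ne_zero _)

lemma isCode_image {hS : IsCuntzPair S} (w : thompson S hS) {s : Finset (List (Fin 2))}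
    (hs : IsCode s) {f : List (Fin 2) → List (Fin 2)}
    (hf : ∀ a ∈ s, ((w : unitary A) : A) * word S a = word S (f a)) :
    IsCode (s.image f) := by
  have hw : star ((w : unitary A) : A) * ((w : unitary A) : A) = 1 := Unitary.coe_star_mul_self _
  constructor
  · intro a' ha' b' hb' hab
    obtain ⟨a, ha, rfl⟩ := Finset.mem_image.1 ha'
    obtain ⟨b, hb, rfl⟩ := Finset.mem_image.1 hb'
    apply hS.perp_of_star_word_mul
    rw [← hf a ha, ← hf b hb, star_mul, mul_assoc, ← mul_assoc (star ((w : unitary A) : A)), hw,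
      one_mul, hS.star_word_mul_of_perp (hs.perp a ha b hb fun h => hab (by rw [h]))]
  · obtain ⟨n, hn⟩ := hs.cover
    obtain ⟨m, hm⟩ := hS.exists_thompson_mul_word (w⁻¹).2
    refine ⟨m + n, fun c hc => ?_⟩
    obtain ⟨b, hb⟩ := hm (c.take m) (by simp; omega)
    obtain ⟨a, ha, t, hat⟩ := hn (b ++ c.drop m) (by simp; omega)
    refine ⟨f a, Finset.mem_image_of_mem f ha, t, hS.word_injective ?_⟩
    have h1 : (((w⁻¹ : thompson S hS) : unitary A) : A) * word S c = word S (a ++ t) := by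
      rw [hat, word_append, ← hb, mul_assoc, ← word_append, List.take_append_drop]
    rw [word_append, ← hf a ha, mul_assoc, ← word_append, ← h1, ← mul_assoc]
    have h2 : ((w : unitary A) : A) * (((w⁻¹ : thompson S hS) : unitary A) : A) = 1 :=
      Unitary.coe_mul_star_self _
    rw [h2, one_mul]

/-- `𝒮₂` is generated by the swaps. -/
theorem eq_top_of_forall_swap_mem {hS : IsCuntzPair S} (K : Subgroup (thompson S hS))
    (hK : ∀ a b, Perp a b → swap hS a b ∈ K) : K = ⊤ := by
  -- Induction on the size of a code that `w` carries to words. Corrected by two exchanges, `w`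
  -- sends a sibling pair to a sibling pair, so both pairs can be merged.
  have main : ∀ n, ∀ s : Finset (List (Fin 2)), s.card = n → IsCode s → ∀ w : thompson S hS,
      (∀ a ∈ s, ∃ b, ((w : unitary A) : A) * word S a = word S b) → w ∈ K := by
    intro n
    induction n using Nat.strong_induction_on with
    | _ n ih =>
    intro s hcard hs w hw
    by_cases hnil : [] ∈ s
    · obtain ⟨b, hb⟩ := hw [] hnil
      rw [word_nil, mul_one] at hb
      have h1 : word S b * star (word S b) = 1 := by
        rw [← hb]; exact Unitary.coe_mul_star_self _
      rw [hS.eq_nil_of_word_mul_star h1, word_nil] at hb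
      rw [thompson_ext (w := 1) hb]
      exact one_mem K
    choose! f hf using hw
    obtain ⟨c, hc0, hc1⟩ := hs.exists_siblings hnil
    have himg := isCode_image w hs hf
    have hnil' : [] ∉ s.image f := by
      intro h
      obtain ⟨a, ha, hfa⟩ := Finset.mem_image.1 h
      have h1 := hf a ha
      rw [hfa, word_nil] at h1
      have h2 : word S a = star ((w : unitary A) : A) := by
        rw [← mul_one (star _), ← h1, ← mul_assoc, Unitary.coe_star_mul_self, one_mul]
      have h3 : word S a * star (word S a) = 1 := by
        rw [h2, star_star]; exact Unitary.coe_star_mul_self _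
      exact hnil (hS.eq_nil_of_word_mul_star h3 ▸ ha)
    obtain ⟨d, hd0, hd1⟩ := himg.exists_siblings hnil'
    obtain ⟨e, he, hed⟩ := Finset.mem_image.1 hd0
    obtain ⟨e', he', hed'⟩ := Finset.mem_image.1 hd1
    have hee : e' ≠ e := by
      rintro rfl
      rw [hed] at hed'
      simp at hed'
    have hcc : c ++ [0] ≠ c ++ [1] := by simp
    obtain ⟨k, hk, hk1, hk2, hk3⟩ := exists_mem_exchange K hK hs hc0 he
    -- The word `x` is the preimage of `e'` under `k`; it differs from `c ++ [0]`, so the exchange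
    -- `l` of `c ++ [1]` and `x` does not disturb `c ++ [0]`.
    obtain ⟨x, hx, hx0, hkx⟩ : ∃ x ∈ s, x ≠ c ++ [0] ∧
        ((k : unitary A) : A) * word S x = word S e' := by
      by_cases h : e' = c ++ [0]
      · exact ⟨e, he, fun h' => hee (h.trans h'.symm), by rw [hk2, h]⟩
      · exact ⟨e', he', h, hk3 e' he' h hee⟩
    obtain ⟨l, hl, hl1, hl2, hl3⟩ := exists_mem_exchange K hK hs hc1 hx
    have hkim : ∀ a ∈ s, ∃ b ∈ s, ((k : unitary A) : A) * word S a = word S b := by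
      intro a ha
      by_cases h1 : a = c ++ [0]
      · exact ⟨e, he, by rw [h1, hk1]⟩
      by_cases h2 : a = e
      · exact ⟨_, hc0, by rw [h2, hk2]⟩
      exact ⟨a, ha, hk3 a ha h1 h2⟩
    have hlim : ∀ a ∈ s, ∃ b ∈ s, ((l : unitary A) : A) * word S a = word S b := by
      intro a ha
      by_cases h1 : a = c ++ [1]
      · exact ⟨x, hx, by rw [h1, hl1]⟩
      by_cases h2 : a = x
      · exact ⟨_, hc1, by rw [h2, hl2]⟩
      exact ⟨a, ha, hl3 a ha h1 h2⟩
    have hcoe : (((w * k * l : thompson S hS) : unitary A) : A)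
        = ((w : unitary A) : A) * ((k : unitary A) : A) * ((l : unitary A) : A) := rfl
    have hu0 : (((w * k * l : thompson S hS) : unitary A) : A) * word S (c ++ [0])
        = word S (d ++ [0]) := by
      rw [hcoe, mul_assoc, hl3 _ hc0 hcc hx0.symm, mul_assoc, hk1, hf e he, hed]
    have hu1 : (((w * k * l : thompson S hS) : unitary A) : A) * word S (c ++ [1])
        = word S (d ++ [1]) := by
      rw [hcoe, mul_assoc, hl1, mul_assoc, hkx, hf e' he', hed']
    have hu : (((w * k * l : thompson S hS) : unitary A) : A) * word S c = word S d := by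
      refine hS.eq_of_forall_mul_word 1 fun a ha => ?_
      obtain ⟨i, rfl⟩ := List.length_eq_one_iff.1 ha
      rw [mul_assoc, ← word_append, ← word_append]
      rcases fin_two_eq_or 0 i with rfl | rfl
      · exact hu0
      · exact hu1
    have hmem : w * k * l ∈ K := by
      refine ih _ (hcard ▸ card_merge_lt hc0 hc1) _ rfl (hs.merge hc0 hc1) _ fun a ha => ?_
      rcases Finset.mem_insert.1 ha with rfl | ha
      · exact ⟨d, hu⟩
      · obtain ⟨b, hb, hab⟩ := hlim a (Finset.mem_of_mem_erase (Finset.mem_of_mem_erase ha))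
        obtain ⟨b', hb', hbb⟩ := hkim b hb
        exact ⟨f b', by rw [hcoe, mul_assoc, hab, mul_assoc, hbb, hf b' hb']⟩
    exact (K.mul_mem_cancel_right hk).1 ((K.mul_mem_cancel_right hl).1 hmem)
  rw [eq_top_iff]
  intro w _
  obtain ⟨n, hn⟩ := hS.exists_thompson_mul_word w.2
  obtain ⟨s, hs, hlen⟩ := exists_isCode_of_le_length n
  exact main _ s rfl hs w fun a ha => hn a (hlen a ha)

/-! ### Non-commutativity, simplicity and the conclusion -/

lemma exists_mul_ne_mul (hS : IsCuntzPair S) : ∃ v w : thompson S hS, v * w ≠ w * v := by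
  have h1 : Perp [0] [1] := perp_cons_of_ne (by decide) _ _
  have h2 : Perp [0, 0] [0, 1] := perp_cons_cons_self.2 h1
  refine ⟨swap hS [0] [1], swap hS [0, 0] [0, 1], fun h => ?_⟩
  have h3 : ((swap hS [0] [1] : unitary A) : A) * ((swap hS [0, 0] [0, 1] : unitary A) : A)
      * word S [0, 0] = ((swap hS [0, 0] [0, 1] : unitary A) : A)
      * ((swap hS [0] [1] : unitary A) : A) * word S [0, 0] :=
    congrArg (fun v : thompson S hS => ((v : unitary A) : A) * word S [0, 0]) h
  have h4 : ∀ i, swapElement S [0] [1] * word S [0, i] = word S [1, i] := fun i => by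
    have := word_append S [0] [i]
    rw [List.singleton_append] at this
    rw [this, ← mul_assoc, hS.swapElement_mul_left h1, ← word_append, List.singleton_append]
  rw [coe_swap hS h1, coe_swap hS h2, mul_assoc, mul_assoc, hS.swapElement_mul_left h2, h4, h4,
    hS.swapElement_mul_of_perp (perp_cons_of_ne (by decide) _ _)
      (perp_cons_of_ne (by decide) _ _)] at h3
  exact absurd (hS.word_injective h3) (by decide)

/-- The Higman–Thompson group `𝒮₂` is simple. -/
theorem isSimpleGroup_thompson (hS : IsCuntzPair S) : IsSimpleGroup (thompson S hS) where
  exists_pair_ne := by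
    obtain ⟨v, w, h⟩ := exists_mul_ne_mul hS
    exact ⟨_, _, h⟩
  eq_bot_or_eq_top_of_normal N hN := by
    by_cases h : N = ⊥
    · exact Or.inl h
    · exact Or.inr (eq_top_of_forall_swap_mem N fun a b hab => forall_swap_mem N h hab)

end
end Cuntz

theorem proposition4p8 {A : Type u} [CStarAlgebra A] [Nontrivial A] (S : Fin 2 → A)
    (hS : Cuntz.IsCuntzPair S) :
    -- every element of `λ(𝒮₂)⁻¹` restricts to an automorphism of `𝒮₂`
    (∀ a ∈ Cuntz.lambdaInv S hS, ∃ t ∈ Cuntz.lambdaRestrict S hS, ∀ v : Cuntz.thompson S hS,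
      ((t v : unitary A) : A) = a ((v : unitary A) : A)) ∧
    -- `Inn(𝒮₂) ⊆ λ(𝒮₂)⁻¹|_{𝒮₂}`, as subgroups of `Aut(𝒮₂)`
    (MulAut.conj : Cuntz.thompson S hS →* MulAut (Cuntz.thompson S hS)).range ≤
      Cuntz.lambdaRestrict S hS ∧
    -- `𝒮₂` is simple and non-abelian
    IsSimpleGroup (Cuntz.thompson S hS) ∧
    (∃ v w : Cuntz.thompson S hS, v * w ≠ w * v) ∧
    Cuntz.IsAlmostSimple (Cuntz.lambdaRestrict S hS) := by
  refine ⟨fun a ha => Cuntz.exists_mem_lambdaRestrict hS ha,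
    Cuntz.range_conj_le_lambdaRestrict hS, Cuntz.isSimpleGroup_thompson hS,
    Cuntz.exists_mul_ne_mul hS, Cuntz.thompson S hS, inferInstance,
    Cuntz.isSimpleGroup_thompson hS, Cuntz.exists_mul_ne_mul hS,
    (Cuntz.lambdaRestrict S hS).subtype, Subgroup.subtype_injective _, ?_⟩
  rw [Subgroup.range_subtype]
  exact Cuntz.range_conj_le_lambdaRestrict hS
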